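/- Let $\mathscr P_N$ be the ring of polynomials over $\mathbb Z$ in commuting variables $x_1,\dots,x_N$ and anticommuting variables $\theta_1,\dots,\theta_N$ ($\theta_i\theta_j=-\theta_j\theta_i$, $\theta_i^2=0$, and $x_i\theta_j=\theta_jx_i$). For $n,m\ge 0$ let $\mathscr P^{S_\infty}_{(n|m)}$ be the $\mathbb Z$-module of symmetric superfunctions of degree $(n|m)$ in infinitely many variables, i.e. of sequences $(f_N)_{N\ge0}$ such that $f_N\in\mathscr P_N$ is homogeneous of degree $n$ in $x$ and $m$ in $\theta$, is invariant under the simultaneous permutations of the $x_i$ and the $\theta_i$, and $f_{N+1}|_{x_{N+1}=\theta_{N+1}=0}=f_N$. Let $\mathscr P^{S_\infty}=\bigoplus_{n,m}\mathscr P^{S_\infty}_{(n|m)}$ be the ring of symmetric superfunctions. A superpartition of $(n|m)$ is $\Lambda=(\Lambda_1,\dots,\Lambda_m;\Lambda_{m+1},\dots,\Lambda_\ell)$ with integers $\Lambda_1>\dots>\Lambda_m\ge 0$ and $\Lambda_{m+1}\ge\dots\ge\Lambda_\ell>0$ and $\sum_i\Lambda_i=n$; write $\Lambda\vdash(n|m)$.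 The monomial function $m_\Lambda$ is the sum of the distinct terms among $\theta_{\sigma(1)}\cdots\theta_{\sigma(m)}\,x_{\sigma(1)}^{\Lambda_1}\cdots x_{\sigma(\ell)}^{\Lambda_\ell}$, over all injective maps $\sigma$ from $\{1,\dots,\ell\}$ to the indices of the variables. For $n\ge0$ put $$e_n=\sum_{\#J=n}\prod_{j\in J}x_j,\qquad \tilde e_n=\sum_{i}\ \sum_{\#J=n,\ i\notin J}\theta_i\prod_{j\in J}x_j,\qquad h_n=\sum_{\Lambda\vdash(n|0)}m_\Lambda,\qquad \tilde h_n=\sum_{\Lambda\vdash(n|1)}(\Lambda_1+1)\,m_\Lambda,$$ and for a superpartition $\Lambda$ put (products taken in this order) $$e_\Lambda=\tilde e_{\Lambda_1}\cdots\tilde e_{\Lambda_m}\,e_{\Lambda_{m+1}}\cdots e_{\Lambda_\ell},\qquad h_\Lambda=\tilde h_{\Lambda_1}\cdots\tilde h_{\Lambda_m}\,h_{\Lambda_{m+1}}\cdots h_{\Lambda_\ell}.$$ **Theorem.** There is exactly one ring homomorphism $\hat\omega:\mathscr P^{S_\infty}\to\mathscr P^{S_\infty}$ such that $\hat\omega(e_n)=h_n$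 and $\hat\omega(\tilde e_n)=\tilde h_n$ for all $n\ge0$. It is an involution, $\hat\omega^2=1$; that is, $\hat\omega(h_n)=e_n$ and $\hat\omega(\tilde h_n)=\tilde e_n$ for all $n\ge 0$. Consequently $\hat\omega(e_\Lambda)=h_\Lambda$ and $\hat\omega(h_\Lambda)=e_\Lambda$ for every superpartition $\Lambda$. Moreover, for all $n,m\ge0$, $\{e_\Lambda:\Lambda\vdash(n|m)\}$ and $\{h_\Lambda:\Lambda\vdash(n|m)\}$ are both $\mathbb Z$-bases of $\mathscr P^{S_\infty}_{(n|m)}$, and, with $\Lambda$ running over all superpartitions, $\{e_\Lambda\}$ and $\{h_\Lambda\}$ are $\mathbb Z$-bases of $\mathscr P^{S_\infty}$. -/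

import Mathlib

open scoped TensorProduct

noncomputable section

namespace SymSuper

variable (R : Type*) [CommRing R]

/-- Polynomials with coefficients in `R` in `N` commuting variables `x_i` and `N` anticommuting
variables `θ_i`: the Grassmann algebra on `θ_1, …, θ_N` over the polynomial ring
`R[x_1, …, x_N]`, obtained from the Grassmann algebra over `R` by extension of scalars. -/
abbrev SuperPoly (N : ℕ) : Type _ :=
  MvPolynomial (Fin N) R ⊗[R] ExteriorAlgebra R (Fin N → R)

/-- The monomial `θ_{j 0} θ_{j 1} ⋯ θ_{j (m-1)} x^μ`. -/
def mono {N m : ℕ} (j : Fin m → Fin N) (μ : Fin N → ℕ) : SuperPoly R N :=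
  (∏ i, (MvPolynomial.X i : MvPolynomial (Fin N) R) ^ μ i) ⊗ₜ[R]
    ExteriorAlgebra.ιMulti R m (fun k => Pi.single (j k) (1 : R))

/-- The diagonal action of a permutation: `x_i ↦ x_{σ i}` and `θ_i ↦ θ_{σ i}`. -/
def permute {N : ℕ} (σ : Equiv.Perm (Fin N)) : SuperPoly R N →ₐ[R] SuperPoly R N :=
  Algebra.TensorProduct.map (MvPolynomial.rename σ)
    (ExteriorAlgebra.map (LinearMap.funLeft R R σ.symm))

/-- Setting the last pair of variables to zero, `x_{N+1} = θ_{N+1} = 0`. -/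
def restrict (N : ℕ) : SuperPoly R (N + 1) →ₐ[R] SuperPoly R N :=
  Algebra.TensorProduct.map
    (MvPolynomial.aeval (Fin.lastCases (0 : MvPolynomial (Fin N) R) MvPolynomial.X))
    (ExteriorAlgebra.map (LinearMap.funLeft R R (Fin.castSucc (n := N))))

/-- The superpolynomials in `N` variables, homogeneous of degree `n` in `x` and `m` in `θ`. -/
def homog (N n m : ℕ) : Submodule R (SuperPoly R N) :=
  Submodule.span R {f | ∃ p ∈ MvPolynomial.homogeneousSubmodule (Fin N) R n,
    ∃ w ∈ ⋀[R]^m (Fin N → R), f = p ⊗ₜ[R] w}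

/-- The symmetric superfunctions (in infinitely many variables) of degree `(n|m)`, as compatible
families of symmetric superpolynomials, homogeneous of degree `(n|m)`, in `N = 0, 1, 2, …`
variables. -/
def familyDeg (n m : ℕ) : Submodule R (∀ N, SuperPoly R N) where
  carrier := {f | (∀ N (σ : Equiv.Perm (Fin N)), permute R σ (f N) = f N) ∧
    (∀ N, restrict R N (f (N + 1)) = f N) ∧ ∀ N, f N ∈ homog R N n m}
  add_mem' := by
    rintro f g ⟨h1, h2, h3⟩ ⟨h1', h2', h3'⟩
    refine ⟨fun N σ => ?_, fun N => ?_, fun N => ?_⟩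
    · rw [Pi.add_apply, map_add, h1, h1']
    · rw [Pi.add_apply, map_add, h2, h2', Pi.add_apply]
    · exact add_mem (h3 N) (h3' N)
  zero_mem' := ⟨fun _ _ => map_zero _, fun _ => map_zero _, fun _ => zero_mem _⟩
  smul_mem' := by
    rintro c f ⟨h1, h2, h3⟩
    refine ⟨fun N σ => ?_, fun N => ?_, fun N => ?_⟩
    · rw [Pi.smul_apply, map_smul, h1]
    · rw [Pi.smul_apply, map_smul, h2, Pi.smul_apply]
    · exact Submodule.smul_mem _ c (h3 N)

theorem homog_mul {N n m n' m' : ℕ} {f g : SuperPoly R N} (hf : f ∈ homog R N n m)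
    (hg : g ∈ homog R N n' m') : f * g ∈ homog R N (n + n') (m + m') := by
  unfold homog at hf hg
  induction hf, hg using Submodule.span_induction₂ with
  | mem_mem x y hx hy =>
    obtain ⟨p, hp, w, hw, rfl⟩ := hx
    obtain ⟨q, hq, v, hv, rfl⟩ := hy
    refine Submodule.subset_span ⟨p * q, ?_, w * v, ?_, ?_⟩
    · exact MvPolynomial.IsHomogeneous.mul hp hq
    · change w * v ∈ _ ^ (m + m')
      rw [pow_add]
      exact Submodule.mul_mem_mul hw hv
    · exact Algebra.TensorProduct.tmul_mul_tmul _ _ _ _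
  | zero_left y hy => rw [zero_mul]; exact zero_mem _
  | zero_right x hx => rw [mul_zero]; exact zero_mem _
  | add_left x y z hx hy hz h1 h2 => rw [add_mul]; exact add_mem h1 h2
  | add_right x y z hx hy hz h1 h2 => rw [mul_add]; exact add_mem h1 h2
  | smul_left r x y hx hy h1 => rw [smul_mul_assoc]; exact Submodule.smul_mem _ r h1
  | smul_right r x y hx hy h1 => rw [mul_smul_comm]; exact Submodule.smul_mem _ r h1

theorem familyDeg_mul {n m n' m' : ℕ} {f g : ∀ N, SuperPoly R N} (hf : f ∈ familyDeg R n m)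
    (hg : g ∈ familyDeg R n' m') : f * g ∈ familyDeg R (n + n') (m + m') := by
  obtain ⟨h1, h2, h3⟩ := hf
  obtain ⟨h1', h2', h3'⟩ := hg
  refine ⟨fun N σ => ?_, fun N => ?_, fun N => homog_mul R (h3 N) (h3' N)⟩
  · rw [Pi.mul_apply, map_mul, h1, h1']
  · rw [Pi.mul_apply, map_mul, h2, h2', Pi.mul_apply]

theorem one_mem_familyDeg : (1 : ∀ N, SuperPoly R N) ∈ familyDeg R 0 0 := by
  refine ⟨fun N σ => map_one _, fun N => map_one _, fun N => Submodule.subset_span ?_⟩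
  refine ⟨1, MvPolynomial.isHomogeneous_one _ _, 1, ?_, rfl⟩
  change (1 : ExteriorAlgebra R (Fin N → R)) ∈ _ ^ 0
  rw [pow_zero]
  exact Submodule.one_le.mp le_rfl

/-- The ring `𝒫^{S_∞}(R)` of symmetric superfunctions: finite sums of homogeneous ones. -/
def SymRing : Subalgebra R (∀ N, SuperPoly R N) :=
  Submodule.toSubalgebra (⨆ d : ℕ × ℕ, familyDeg R d.1 d.2)
    (Submodule.mem_iSup_of_mem (0, 0) (one_mem_familyDeg R)) (by
      intro f g hf hg
      have h : (⨆ d : ℕ × ℕ, familyDeg R d.1 d.2) * (⨆ d : ℕ × ℕ, familyDeg R d.1 d.2) ≤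
          ⨆ d : ℕ × ℕ, familyDeg R d.1 d.2 := by
        rw [Submodule.iSup_mul]
        refine iSup_le fun d => ?_
        rw [Submodule.mul_iSup]
        refine iSup_le fun d' => Submodule.mul_le.mpr fun a ha b hb => ?_
        exact Submodule.mem_iSup_of_mem (d.1 + d'.1, d.2 + d'.2) (familyDeg_mul R ha hb)
      exact h (Submodule.mul_mem_mul hf hg))

theorem mem_SymRing_of_mem {n m : ℕ} {f : ∀ N, SuperPoly R N} (hf : f ∈ familyDeg R n m) :
    f ∈ SymRing R :=
  Submodule.mem_iSup_of_mem (p := fun d : ℕ × ℕ => familyDeg R d.1 d.2) (n, m) hf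

/-- The submodule `𝒫^{S_∞}_{(n|m)}(R)` of `𝒫^{S_∞}(R)`. -/
def SymDeg (n m : ℕ) : Submodule R (SymRing R) :=
  (familyDeg R n m).comap (SymRing R).val.toLinearMap

/-- A superpartition `(Λ_1, …, Λ_m; Λ_{m+1}, …)`: a strictly decreasing list of non-negative
integers, followed by a partition (written without its zero entries, which carry no
information). -/
@[ext]
structure SPar where
  anti : List ℕ
  symm : List ℕ
  anti_sorted : anti.Pairwise (· > ·)
  symm_sorted : symm.Pairwise (· ≥ ·)
  symm_pos : ∀ a ∈ symm, 0 < a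

/-- The bosonic degree. -/
def SPar.deg (L : SPar) : ℕ := L.anti.sum + L.symm.sum

/-- The fermionic degree. -/
def SPar.fdeg (L : SPar) : ℕ := L.anti.length

/-- The superpartitions of `(n|m)`. -/
abbrev SParDeg (n m : ℕ) : Type := {L : SPar // L.deg = n ∧ L.fdeg = m}

instance (n m : ℕ) : Finite (SParDeg n m) := by
  have hfin : Set.Finite {l : List ℕ | l.length ≤ m + n ∧ ∀ a ∈ l, a ≤ n} := by
    refine ((List.finite_length_le (Fin (n + 1)) (m + n)).image (List.map Fin.val)).subset ?_
    rintro l ⟨hl, hb⟩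
    refine ⟨l.pmap (fun a h => ⟨a, Nat.lt_succ_of_le h⟩) hb, by simpa using hl, ?_⟩
    simp [List.map_pmap]
  have : Finite {l : List ℕ | l.length ≤ m + n ∧ ∀ a ∈ l, a ≤ n} := hfin
  let T := {l : List ℕ | l.length ≤ m + n ∧ ∀ a ∈ l, a ≤ n}
  have hlen : ∀ l : List ℕ, (∀ a ∈ l, 0 < a) → l.length ≤ l.sum := by
    intro l
    induction l with
    | nil => simp
    | cons a l ih =>
      intro h
      have h1 := h a (by simp)
      have h2 := ih fun b hb => h b (by simp [hb])
      simp only [List.length_cons, List.sum_cons]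
      omega
  refine Finite.of_injective (β := T × T) (fun L =>
    (⟨L.1.anti, ?_, fun a ha => ?_⟩, ⟨L.1.symm, ?_, fun a ha => ?_⟩)) ?_
  · have := L.2.2
    unfold SPar.fdeg at this
    omega
  · have h1 := L.2.1
    have h2 := List.le_sum_of_mem ha
    unfold SPar.deg at h1
    omega
  · have h1 := L.2.1
    have h2 := hlen _ L.1.symm_pos
    unfold SPar.deg at h1
    omega
  · have h1 := L.2.1
    have h2 := List.le_sum_of_mem ha
    unfold SPar.deg at h1
    omega
  · intro L M h
    simp only [Prod.mk.injEq, Subtype.mk.injEq] at h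
    exact Subtype.ext (SPar.ext h.1 h.2)

instance (n m : ℕ) : Fintype (SParDeg n m) := Fintype.ofFinite _

theorem mono_mem_homog {N m : ℕ} (j : Fin m → Fin N) (μ : Fin N → ℕ) :
    mono R j μ ∈ homog R N (∑ i, μ i) m := by
  refine Submodule.subset_span ⟨_, ?_, _, ?_, rfl⟩
  · refine MvPolynomial.IsHomogeneous.prod _ _ _ fun i _ => ?_
    simpa using (MvPolynomial.isHomogeneous_X R i).pow (μ i)
  · exact ExteriorAlgebra.ιMulti_range R m (Set.mem_range_self _)

theorem permute_mono {N m : ℕ} (σ : Equiv.Perm (Fin N)) (j : Fin m → Fin N) (μ : Fin N → ℕ) :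
    permute R σ (mono R j μ) = mono R (σ ∘ j) (μ ∘ σ.symm) := by
  unfold permute mono
  rw [Algebra.TensorProduct.map_tmul, ExteriorAlgebra.map_apply_ιMulti, map_prod]
  congr 1
  · simp only [map_pow, MvPolynomial.rename_X]
    exact Fintype.prod_equiv σ _ _ fun i => by simp
  · congr 1
    funext k i
    simp [LinearMap.funLeft_apply, Pi.single_apply, Equiv.symm_apply_eq]

theorem restrict_mono_snoc {N m : ℕ} (j : Fin m → Fin N) (μ : Fin N → ℕ) :
    restrict R N (mono R (Fin.castSucc ∘ j) (Fin.snoc μ 0 : Fin (N + 1) → ℕ)) = mono R j μ := by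
  unfold restrict mono
  rw [Algebra.TensorProduct.map_tmul, ExteriorAlgebra.map_apply_ιMulti, map_prod]
  congr 1
  · rw [Fin.prod_univ_castSucc]
    simp
  · congr 1
    funext k i
    simp [LinearMap.funLeft_apply, Pi.single_apply]

theorem restrict_mono_eq_zero {N m : ℕ} (j : Fin m → Fin (N + 1)) (μ : Fin (N + 1) → ℕ)
    (h : (∃ k, j k = Fin.last N) ∨ μ (Fin.last N) ≠ 0) : restrict R N (mono R j μ) = 0 := by
  unfold restrict mono
  rw [Algebra.TensorProduct.map_tmul, ExteriorAlgebra.map_apply_ιMulti, map_prod]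
  rcases h with ⟨k, hk⟩ | h
  · rw [(ExteriorAlgebra.ιMulti R m).map_coord_zero k, TensorProduct.tmul_zero]
    funext i
    simp [LinearMap.funLeft_apply, hk, Fin.castSucc_ne_last]
  · rw [Finset.prod_eq_zero (Finset.mem_univ (Fin.last N)), TensorProduct.zero_tmul]
    simp [h]

/-- The sum of the monomials `θ_{j 0} ⋯ θ_{j (m-1)} x^μ` over all pairs `(j, μ)` with `|μ| = n`
that satisfy the condition `C`. -/
def monoSum (N n m : ℕ) (C : (Fin m → Fin N) → (Fin N → ℕ) → Prop) : SuperPoly R N :=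
  open Classical in
  ∑ q ∈ (Finset.univ (α := Fin m → Fin N) ×ˢ Finset.piAntidiag Finset.univ n).filter
    (fun q => C q.1 q.2), mono R q.1 q.2

theorem monoSum_mem (n m : ℕ) (C : ∀ N, (Fin m → Fin N) → (Fin N → ℕ) → Prop)
    (hperm : ∀ N (σ : Equiv.Perm (Fin N)) j μ, C N j μ → C N (σ ∘ j) (μ ∘ σ.symm))
    (hres : ∀ N j μ, C (N + 1) (Fin.castSucc ∘ j) (Fin.snoc μ 0 : Fin (N + 1) → ℕ) ↔ C N j μ) :
    (fun N => monoSum R N n m (C N)) ∈ familyDeg R n m := by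
  classical
  refine ⟨fun N σ => ?_, fun N => ?_, fun N => ?_⟩
  · unfold monoSum
    rw [map_sum]
    refine Finset.sum_bij' (fun q _ => (σ ∘ q.1, q.2 ∘ σ.symm))
      (fun q _ => (σ.symm ∘ q.1, q.2 ∘ σ)) ?_ ?_ ?_ ?_ ?_
    · rintro ⟨j, μ⟩ h
      simp only [Finset.mem_filter, Finset.mem_product, Finset.mem_univ, true_and,
        Finset.mem_piAntidiag, ne_eq, implies_true, and_true] at h ⊢
      refine ⟨?_, hperm N σ j μ h.2⟩
      rw [← h.1]
      exact Equiv.sum_comp σ.symm μ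
    · rintro ⟨j, μ⟩ h
      simp only [Finset.mem_filter, Finset.mem_product, Finset.mem_univ, true_and,
        Finset.mem_piAntidiag, ne_eq, implies_true, and_true] at h ⊢
      refine ⟨?_, hperm N σ.symm j μ h.2⟩
      rw [← h.1]
      exact Equiv.sum_comp σ μ
    · rintro ⟨j, μ⟩ _
      simp [Function.comp_def]
    · rintro ⟨j, μ⟩ _
      simp [Function.comp_def]
    · rintro ⟨j, μ⟩ _
      exact permute_mono R σ j μ
  · unfold monoSum
    rw [map_sum]
    symm
    refine Finset.sum_of_injOn
      (fun q => (Fin.castSucc ∘ q.1, (Fin.snoc q.2 0 : Fin (N + 1) → ℕ))) ?_ ?_ ?_ ?_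
    · rintro ⟨j, μ⟩ _ ⟨j', μ'⟩ _ h
      simp only [Prod.mk.injEq] at h
      refine Prod.ext ?_ ?_
      · exact (Fin.castSucc_injective N).comp_left h.1
      · funext i
        simpa using congrFun h.2 i.castSucc
    · rintro ⟨j, μ⟩ h
      simp only [Finset.coe_filter, Set.mem_ofPred_eq, Finset.mem_product, Finset.mem_univ,
        true_and, Finset.mem_piAntidiag, ne_eq, implies_true, and_true] at h ⊢
      refine ⟨?_, (hres N j μ).2 h.2⟩
      rw [Fin.sum_univ_castSucc]
      simpa using h.1
    · rintro ⟨j, μ⟩ h hn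
      refine restrict_mono_eq_zero R j μ ?_
      by_contra hc
      push Not at hc
      obtain ⟨hc1, hc2⟩ := hc
      apply hn
      have hj : ∃ j' : Fin m → Fin N, j = Fin.castSucc ∘ j' :=
        ⟨fun k => (j k).castPred (hc1 k), by funext k; simp⟩
      have hμ : ∃ μ' : Fin N → ℕ, μ = (Fin.snoc μ' 0 : Fin (N + 1) → ℕ) := by
        refine ⟨fun i => μ i.castSucc, ?_⟩
        funext i
        refine Fin.lastCases ?_ (fun i => ?_) i
        · simpa using hc2
        · simp
      obtain ⟨j', rfl⟩ := hj
      obtain ⟨μ', rfl⟩ := hμ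
      refine ⟨(j', μ'), ?_, rfl⟩
      simp only [Finset.coe_filter, Finset.mem_filter, Set.mem_ofPred_eq, Finset.mem_product,
        Finset.mem_univ, true_and, Finset.mem_piAntidiag, ne_eq, implies_true, and_true] at h ⊢
      refine ⟨?_, (hres N j' μ').1 h.2⟩
      have h1 := h.1
      rw [Fin.sum_univ_castSucc] at h1
      simpa using h1
    · rintro ⟨j, μ⟩ _
      exact (restrict_mono_snoc R j μ).symm
  · refine Submodule.sum_mem _ fun q hq => ?_
    simp only [Finset.mem_filter, Finset.mem_product, Finset.mem_univ, true_and,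
      Finset.mem_piAntidiag, ne_eq, implies_true, and_true] at hq
    rw [← hq.1]
    exact mono_mem_homog R _ _

/-- The superfunction whose part in `N` variables is `monoSum N n m (C N)`. -/
def ofMono (n m : ℕ) (C : ∀ N, (Fin m → Fin N) → (Fin N → ℕ) → Prop)
    (hperm : ∀ N (σ : Equiv.Perm (Fin N)) j μ, C N j μ → C N (σ ∘ j) (μ ∘ σ.symm))
    (hres : ∀ N j μ, C (N + 1) (Fin.castSucc ∘ j) (Fin.snoc μ 0 : Fin (N + 1) → ℕ) ↔ C N j μ) :
    SymRing R :=
  ⟨fun N => monoSum R N n m (C N), mem_SymRing_of_mem R (monoSum_mem R n m C hperm hres)⟩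

/-- The pairs `(j, μ)` for which `θ_{j 0} ⋯ θ_{j (m-1)} x^μ` is one of the (distinct) terms of
`m_Λ`: the variable `x_{j k}` has exponent `Λ_{k+1}` for `k < m` (so the `j k` are distinct), and
the non-zero exponents of the remaining variables are, up to order, the parts of `Λ^s`. -/
def IsTerm (L : SPar) (N : ℕ) (j : Fin L.fdeg → Fin N) (μ : Fin N → ℕ) : Prop :=
  (∀ k, μ (j k) = L.anti.get k) ∧
    (((Finset.univ.filter fun i => ∀ k, j k ≠ i).val.map μ).filter (· ≠ 0)) =
      (L.symm : Multiset ℕ)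

/-- The monomial symmetric superfunction `m_Λ`. -/
def msym (L : SPar) : SymRing R :=
  ofMono R L.deg L.fdeg (IsTerm L)
    (by
      rintro N σ j μ ⟨h1, h2⟩
      refine ⟨fun k => by simpa using h1 k, ?_⟩
      rw [← h2]
      have : (Finset.univ.filter fun i => ∀ k, (σ ∘ j) k ≠ i) =
          (Finset.univ.filter fun i => ∀ k, j k ≠ i).map σ.toEmbedding := by
        ext i
        simp [Finset.mem_map_equiv, ← Equiv.eq_symm_apply]
      rw [this, Finset.map_val, Multiset.map_map]
      congr 2
      funext i
      simp)
    (by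
      intro N j μ
      unfold IsTerm
      refine and_congr (by simp) ?_
      have : (Finset.univ.filter fun i => ∀ k, (Fin.castSucc ∘ j) k ≠ i) =
          Finset.cons (Fin.last N)
            ((Finset.univ.filter fun i => ∀ k, j k ≠ i).map Fin.castSuccEmb)
            (by simp [Fin.castSucc_ne_last]) := by
        ext i
        refine Fin.lastCases ?_ (fun i => ?_) i
        · simp [Fin.castSucc_ne_last]
        · simp [Fin.castSucc_ne_last]
      rw [this, Finset.cons_val, Multiset.map_cons, Finset.map_val, Multiset.map_map]
      simp [Function.comp_def])

/-- `e_n = ∑_{#J = n} ∏_{j ∈ J} x_j`. The set `J` is given by its indicator function `μ`. -/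
def e (n : ℕ) : SymRing R :=
  ofMono R n 0 (fun _ _ μ => ∀ i, μ i ≤ 1)
    (fun _ σ _ _ h i => h (σ.symm i))
    (fun N j μ => by
      rw [Fin.forall_fin_succ']
      simp)

/-- `ẽ_n = ∑_i ∑_{#J = n, i ∉ J} θ_i ∏_{j ∈ J} x_j`, where the index `i` is the value `j 0` and
the set `J` is given by its indicator function `μ`. -/
def et (n : ℕ) : SymRing R :=
  ofMono R n 1 (fun _ j μ => (∀ i, μ i ≤ 1) ∧ μ (j 0) = 0)
    (fun _ σ j μ h => ⟨fun i => h.1 (σ.symm i), by simpa using h.2⟩)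
    (fun N j μ => by
      rw [Fin.forall_fin_succ']
      simp)

/-- `h_n = ∑_{λ ⊢ n} m_λ`, the partitions being the superpartitions without fermionic part. -/
def h (n : ℕ) : SymRing R := ∑ L : SParDeg n 0, msym R L.1

/-- `h̃_n = ∑_{Λ ⊢ (n|1)} (Λ_1 + 1) m_Λ`. -/
def ht (n : ℕ) : SymRing R :=
  ∑ L : SParDeg n 1, (L.1.anti.headD 0 + 1) • msym R L.1

/-- `e_Λ = ẽ_{Λ_1} ⋯ ẽ_{Λ_m} e_{Λ_{m+1}} ⋯ e_{Λ_ℓ}`, in this order. -/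
def eProd (L : SPar) : SymRing R := (L.anti.map (et R)).prod * (L.symm.map (e R)).prod

/-- `h_Λ = h̃_{Λ_1} ⋯ h̃_{Λ_m} h_{Λ_{m+1}} ⋯ h_{Λ_ℓ}`, in this order. -/
def hProd (L : SPar) : SymRing R := (L.anti.map (ht R)).prod * (L.symm.map (h R)).prod

end SymSuper

end

/-! Everything rests on generating series in a central variable t. With E(t) = ∏ (1 + x_i t), H(t) =
∏ (1 - x_i t)⁻¹, and Ẽ, H̃ the series of the ẽ_n, h̃_n, one has Ẽ(t) = E(t) ∑ θ_i / (1 + x_i t) and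
H̃(t) = H(t) ∑ θ_i / (1 - x_i t). The weight Λ_1 + 1 in h̃_n is what produces the double pole (1 -
x_i t)⁻². Hence E(-t) H(t) = 1 and E(-t) H̃(t) = Ẽ(-t) H(t) = ∑ p̃_n t^n, where p̃_n = ∑ x_i^n θ_i
(`sum_e_mul_h`, `sum_e_mul_ht`, `pt_val`).

If ω sends e to h and ẽ to h̃, apply ω to these relations, replace t by -t in the original ones, and
cancel the invertible series H(-t): this gives ω(h) = e and ω(h̃) = ẽ (`map_dual_even`,
`map_dual_odd`).

Existence of ω needs the e_Λ to be a basis. Then e_Λ ↦ h_Λ defines a linear map. It is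
multiplicative because left multiplication of an ordered product by a generator follows a rule that
uses only centrality, anticommutation and vanishing squares, which hold on both sides
(`IsSuperPair.exists_algHom`). The h_Λ are then a basis, as images of one under an involution.

For the basis property in degree (n|m), a superfunction is determined by the coefficient of θ_{n+1}
⋯ θ_{n+m} in n + m variables (`topCoeff_injective`). Symmetry forces the lexicographically leading
exponent of this polynomial to decrease weakly on the first n places and strictly on the last m
(`mem_topExps`). Each such exponent is the leading one, with coefficient 1, of a product of p̃'s and
e's: the p̃'s contribute a determinant of powers, the e's any partition (`isLead_leadElem`). So
these products form a basis. They are polynomials in the e's and ẽ's, hence the e_Λ of degree (n|m)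
span. There are no more of them than basis elements, and a surjective endomorphism of a finitely
generated module is injective, so they are independent. -/

noncomputable section

namespace SymSuper

/-! ### Generating series over a commutative ring. -/

section Series

variable {ι A : Type*} [Fintype ι] [CommRing A]

/-- The power series `∏ i, ∑ k, w i k * x i ^ k * t ^ k`. -/
def weightSeries (x : ι → A) (w : ι → ℕ → ℕ) : PowerSeries A :=
  ∏ i, PowerSeries.mk fun k => w i k • x i ^ k

theorem coeff_weightSeries [DecidableEq ι] (x : ι → A) (w : ι → ℕ → ℕ) (n : ℕ) :
    PowerSeries.coeff n (weightSeries x w) =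
      ∑ μ ∈ Finset.piAntidiag Finset.univ n, (∏ i, w i (μ i)) • ∏ i, x i ^ μ i := by
  rw [weightSeries, PowerSeries.coeff_prod]
  refine Finset.sum_bij' (fun μ _ => (μ : ι → ℕ)) (fun μ _ => Finsupp.equivFunOnFinite.symm μ)
    ?_ ?_ ?_ ?_ ?_
  · intro μ hμ
    simpa using hμ
  · intro μ hμ
    simpa using hμ
  · intro μ _
    ext; simp
  · intro μ _
    ext; simp
  · intro μ _
    simp [Finset.prod_mul_distrib]

/-- Only the factor of `j` changes; the identity is cross-multiplied so that no factor has to be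
inverted. -/
theorem weightSeries_update [DecidableEq ι] (x : ι → A) (w : ι → ℕ → ℕ) (j : ι) (v : ℕ → ℕ) :
    weightSeries x (Function.update w j v) * (PowerSeries.mk fun k => w j k • x j ^ k) =
      weightSeries x w * PowerSeries.mk fun k => v k • x j ^ k := by
  unfold weightSeries
  rw [← Finset.mul_prod_erase _ _ (Finset.mem_univ j),
    ← Finset.mul_prod_erase _ (fun i => PowerSeries.mk fun k => w i k • x i ^ k)
      (Finset.mem_univ j), Function.update_self]
  have : ∏ i ∈ Finset.univ.erase j, (PowerSeries.mk fun k => Function.update w j v i k • x i ^ k) =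
      ∏ i ∈ Finset.univ.erase j, PowerSeries.mk fun k => w i k • x i ^ k :=
    Finset.prod_congr rfl fun i hi => by rw [Function.update_of_ne (Finset.ne_of_mem_erase hi)]
  rw [this]
  ring

/-- The weights selecting exponents at most one. -/
def weightE : ℕ → ℕ := fun k => if k ≤ 1 then 1 else 0

/-- The weights selecting the exponent zero. -/
def weightZero : ℕ → ℕ := fun k => if k = 0 then 1 else 0

theorem mk_weightE (a : A) : (PowerSeries.mk fun k => weightE k • a ^ k) =
    1 + PowerSeries.C a * PowerSeries.X := by
  ext k
  rcases k with _ | _ | k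
  · simp [weightE]
  · simp [weightE, PowerSeries.coeff_one]
  · rw [map_add, PowerSeries.coeff_succ_mul_X]
    simp [weightE, PowerSeries.coeff_one]

theorem mk_weightZero (a : A) : (PowerSeries.mk fun k => weightZero k • a ^ k) = 1 := by
  ext k
  rcases k with _ | k <;> simp [weightZero, PowerSeries.coeff_one]

theorem one_sub_mul_mk_pow (a : A) :
    (1 - PowerSeries.C a * PowerSeries.X) * (PowerSeries.mk fun k => (1 : ℕ) • a ^ k) = 1 := by
  ext k
  rw [sub_mul, mul_assoc, one_mul, map_sub, PowerSeries.coeff_C_mul]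
  rcases k with _ | k
  · simp
  · rw [PowerSeries.coeff_succ_X_mul]
    simp [PowerSeries.coeff_one, pow_succ']

theorem one_sub_mul_mk_succ_mul_pow (a : A) :
    (1 - PowerSeries.C a * PowerSeries.X) * (PowerSeries.mk fun k => (k + 1 : ℕ) • a ^ k) =
      PowerSeries.mk fun k => (1 : ℕ) • a ^ k := by
  ext k
  rw [sub_mul, mul_assoc, one_mul, map_sub, PowerSeries.coeff_C_mul]
  rcases k with _ | k
  · simp
  · rw [PowerSeries.coeff_succ_X_mul]
    simp only [PowerSeries.coeff_mk, nsmul_eq_mul, pow_succ']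
    push_cast
    ring

theorem evalNegHom_one_add (a : A) :
    PowerSeries.evalNegHom (1 + PowerSeries.C a * PowerSeries.X) =
      1 - PowerSeries.C a * PowerSeries.X := by
  ext k
  rcases k with _ | _ | k
  · simp [PowerSeries.evalNegHom]
  · simp [PowerSeries.evalNegHom, PowerSeries.coeff_one]
  · simp [PowerSeries.evalNegHom, PowerSeries.coeff_one, PowerSeries.coeff_succ_mul_X]

theorem coeff_evalNegHom (f : PowerSeries A) (n : ℕ) :
    PowerSeries.coeff n (PowerSeries.evalNegHom f) = (-1) ^ n * PowerSeries.coeff n f := by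
  simp [PowerSeries.evalNegHom, PowerSeries.coeff_rescale]

theorem evalNegHom_weightE_mul_weight_one (x : ι → A) :
    PowerSeries.evalNegHom (weightSeries x fun _ => weightE) * weightSeries x (fun _ _ => 1) =
      1 := by
  unfold weightSeries
  rw [map_prod, ← Finset.prod_mul_distrib]
  refine Finset.prod_eq_one fun i _ => ?_
  rw [mk_weightE, evalNegHom_one_add, one_sub_mul_mk_pow]

theorem evalNegHom_weightE_mul_update [DecidableEq ι] (x : ι → A) (j : ι) :
    PowerSeries.evalNegHom (weightSeries x fun _ => weightE) *
      weightSeries x (Function.update (fun _ _ => 1) j fun k => k + 1) =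
      PowerSeries.mk fun k => (1 : ℕ) • x j ^ k := by
  have h1 := weightSeries_update x (fun _ _ => 1) j fun k => k + 1
  have h2 := evalNegHom_weightE_mul_weight_one x
  have h3 := one_sub_mul_mk_succ_mul_pow (x j)
  have h4 := one_sub_mul_mk_pow (x j)
  set P := PowerSeries.mk fun k => (1 : ℕ) • x j ^ k
  set Q := PowerSeries.mk fun k => (k + 1 : ℕ) • x j ^ k
  set E := PowerSeries.evalNegHom (weightSeries x fun _ => weightE)
  set W := weightSeries x (Function.update (fun _ _ => 1) j fun k => k + 1)
  -- With `c = 1 - x_j t`, `P = 1/c` and `Q = 1/c²`: insert `1 = P * c`, trade `W * P` for the full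
  -- product times `Q`, and cancel the latter against `E`.
  set c := 1 - PowerSeries.C (x j) * PowerSeries.X
  calc E * W = E * (W * P) * c := by linear_combination (-E * W) * h4
    _ = P := by rw [h1]; linear_combination c * Q * h2 + h3

theorem evalNegHom_update_mul_weight_one [DecidableEq ι] (x : ι → A) (j : ι) :
    PowerSeries.evalNegHom (weightSeries x (Function.update (fun _ => weightE) j weightZero)) *
      weightSeries x (fun _ _ => 1) = PowerSeries.mk fun k => (1 : ℕ) • x j ^ k := by
  have h1 := congrArg PowerSeries.evalNegHom
    (weightSeries_update x (fun _ => weightE) j weightZero)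
  rw [mk_weightE, mk_weightZero, map_mul, mul_one, evalNegHom_one_add] at h1
  have h2 := evalNegHom_weightE_mul_weight_one x
  have h4 := one_sub_mul_mk_pow (x j)
  set P := PowerSeries.mk fun k => (1 : ℕ) • x j ^ k
  linear_combination (-PowerSeries.evalNegHom (weightSeries x (Function.update (fun _ => weightE) j weightZero)) *
      weightSeries x (fun _ _ => 1)) * h4 + weightSeries x (fun _ _ => 1) * P * h1 + P * h2

end Series

/-! ### The generators in `N` variables. -/

section Values

variable (R : Type*) [CommRing R] {N : ℕ}

/-- The odd superpolynomial `∑ i, v i * θ_i`. -/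
def oddPart : (Fin N → MvPolynomial (Fin N) R) →ₗ[R] SuperPoly R N :=
  ∑ i, ((TensorProduct.mk R _ _).flip (ExteriorAlgebra.ι R (Pi.single i 1))).comp
    (LinearMap.proj i)

theorem oddPart_apply (v : Fin N → MvPolynomial (Fin N) R) :
    oddPart R v = ∑ i, v i ⊗ₜ[R] ExteriorAlgebra.ι R (Pi.single i (1 : R)) := by
  simp [oddPart]

/-- The even superpolynomial `p`. -/
def evenPart : MvPolynomial (Fin N) R →ₐ[R] SuperPoly R N :=
  Algebra.TensorProduct.includeLeft

theorem evenPart_apply (p : MvPolynomial (Fin N) R) : evenPart R p = p ⊗ₜ[R] 1 := rfl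

theorem evenPart_mul_oddPart (p : MvPolynomial (Fin N) R) (v : Fin N → MvPolynomial (Fin N) R) :
    evenPart R p * oddPart R v = oddPart R fun i => p * v i := by
  simp [oddPart_apply, evenPart_apply, Finset.mul_sum]

theorem evenPart_commute (p : MvPolynomial (Fin N) R) (f : SuperPoly R N) :
    evenPart R p * f = f * evenPart R p := by
  rw [evenPart_apply]
  induction f using TensorProduct.induction_on with
  | zero => simp
  | tmul q w => simp [mul_comm]
  | add f g hf hg => rw [mul_add, hf, hg, add_mul]

theorem oddPart_mul_anticomm (v w : Fin N → MvPolynomial (Fin N) R) :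
    oddPart R v * oddPart R w + oddPart R w * oddPart R v = 0 := by
  rw [oddPart_apply, oddPart_apply, Finset.sum_mul_sum, Finset.sum_mul_sum, Finset.sum_comm,
    ← Finset.sum_add_distrib]
  refine Finset.sum_eq_zero fun i _ => ?_
  rw [← Finset.sum_add_distrib]
  refine Finset.sum_eq_zero fun j _ => ?_
  rw [Algebra.TensorProduct.tmul_mul_tmul, Algebra.TensorProduct.tmul_mul_tmul,
    mul_comm (w i), ← TensorProduct.tmul_add, ExteriorAlgebra.ι_add_mul_swap,
    TensorProduct.tmul_zero]

/-- Anticommutation alone gives only `2 v² = 0`, which says too little when 2 is a zero divisor.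
Adding one term at a time, the cross terms cancel in pairs and the diagonal ones vanish by `θ_i² =
0`. -/
theorem oddPart_mul_self (v : Fin N → MvPolynomial (Fin N) R) :
    oddPart R v * oddPart R v = 0 := by
  classical
  have key : ∀ s : Finset (Fin N), oddPart R (∑ i ∈ s, Pi.single i (v i)) *
      oddPart R (∑ i ∈ s, Pi.single i (v i)) = 0 := by
    intro s
    induction s using Finset.induction_on with
    | empty => simp
    | insert a s ha ih =>
      rw [Finset.sum_insert ha, map_add, add_mul, mul_add, mul_add, ih, add_zero, add_assoc,
        oddPart_mul_anticomm, add_zero, oddPart_apply, Finset.sum_eq_single a]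
      · simp
      · intro b _ hb
        simp [hb]
      · simp
  simpa [Finset.univ_sum_single] using key Finset.univ

/-- The weighted sum of all monomials `θ_{j 0} ⋯ θ_{j (m-1)} x^μ` with `|μ| = n`. -/
def weightSum (N n m : ℕ) (c : (Fin m → Fin N) → (Fin N → ℕ) → ℕ) : SuperPoly R N :=
  ∑ j : Fin m → Fin N, ∑ μ ∈ Finset.piAntidiag Finset.univ n, c j μ • mono R j μ

open Classical in
theorem monoSum_eq_weightSum (n m : ℕ) (c : (Fin m → Fin N) → (Fin N → ℕ) → Prop) :
    monoSum R N n m c = weightSum R N n m fun j μ => if c j μ then 1 else 0 := by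
  rw [monoSum, Finset.sum_filter, Finset.sum_product]
  refine Finset.sum_congr rfl fun j _ => Finset.sum_congr rfl fun μ _ => ?_
  dsimp only
  split_ifs <;> simp

theorem weightSum_zero (n : ℕ) (c : (Fin 0 → Fin N) → (Fin N → ℕ) → ℕ) (w : Fin N → ℕ → ℕ)
    (hw : ∀ j μ, c j μ = ∏ i, w i (μ i)) :
    weightSum R N n 0 c = evenPart R (PowerSeries.coeff n (weightSeries MvPolynomial.X w)) := by
  rw [coeff_weightSeries, weightSum, Fintype.sum_unique, evenPart_apply, TensorProduct.sum_tmul]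
  refine Finset.sum_congr rfl fun μ _ => ?_
  rw [hw, mono, ← TensorProduct.smul_tmul']
  simp [ExteriorAlgebra.ιMulti_apply]

theorem weightSum_one (n : ℕ) (c : (Fin 1 → Fin N) → (Fin N → ℕ) → ℕ)
    (w : Fin N → Fin N → ℕ → ℕ) (hw : ∀ j μ, c j μ = ∏ i, w (j 0) i (μ i)) :
    weightSum R N n 1 c =
      oddPart R fun k => PowerSeries.coeff n (weightSeries MvPolynomial.X (w k)) := by
  rw [weightSum, oddPart_apply, ← (Equiv.funUnique (Fin 1) (Fin N)).sum_comp]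
  refine Finset.sum_congr rfl fun j _ => ?_
  rw [coeff_weightSeries, TensorProduct.sum_tmul]
  refine Finset.sum_congr rfl fun μ _ => ?_
  rw [hw, mono, ← TensorProduct.smul_tmul']
  simp [ExteriorAlgebra.ιMulti_apply]

theorem e_val (n : ℕ) : (e R n).1 N =
    evenPart R (PowerSeries.coeff n (weightSeries MvPolynomial.X fun _ => weightE)) := by
  classical
  have : (e R n).1 N = monoSum R N n 0 fun _ μ => ∀ i, μ i ≤ 1 := rfl
  rw [this, monoSum_eq_weightSum]
  refine weightSum_zero R n _ _ fun j μ => ?_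
  simp [weightE, Finset.prod_ite_zero]

theorem et_val (n : ℕ) : (et R n).1 N = oddPart R fun k => PowerSeries.coeff n
    (weightSeries MvPolynomial.X (Function.update (fun _ => weightE) k weightZero)) := by
  classical
  have : (et R n).1 N = monoSum R N n 1 fun j μ => (∀ i, μ i ≤ 1) ∧ μ (j 0) = 0 := rfl
  rw [this, monoSum_eq_weightSum]
  refine weightSum_one R n _ _ fun j μ => ?_
  rw [← Finset.mul_prod_erase _ _ (Finset.mem_univ (j 0)), Function.update_self]
  rw [Finset.prod_congr rfl fun i hi => by
    rw [Function.update_of_ne (Finset.ne_of_mem_erase hi)]]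
  by_cases h0 : μ (j 0) = 0
  · simp only [h0, weightZero, weightE, Finset.prod_ite_zero, and_true]
    simp only [if_true, one_mul, Finset.prod_const_one, Finset.mem_erase, Finset.mem_univ, and_true]
    refine if_congr ⟨fun h i _ => h i, fun h i => ?_⟩ rfl rfl
    by_cases hi : i = j 0
    · rw [hi, h0]; exact Nat.zero_le _
    · exact h i hi
  · simp [h0, weightZero]

/-- The monomials of `m_Λ`, for `Λ` of fermionic degree `m`. -/
def IsTermOf (L : SPar) {m : ℕ} (hm : L.fdeg = m) (j : Fin m → Fin N) (μ : Fin N → ℕ) : Prop :=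
  IsTerm L N (j ∘ Fin.cast hm) μ

open Classical in
theorem msym_val {n m : ℕ} (L : SPar) (hn : L.deg = n) (hm : L.fdeg = m) :
    (msym R L).1 N = weightSum R N n m fun j μ => if IsTermOf L hm j μ then 1 else 0 := by
  subst hn hm
  exact monoSum_eq_weightSum R _ _ _

theorem IsTermOf.anti_eq {L : SPar} {m : ℕ} {hm : L.fdeg = m} {j : Fin m → Fin N}
    {μ : Fin N → ℕ} (ht : IsTermOf L hm j μ) : L.anti = List.ofFn (μ ∘ j) := by
  subst hm
  conv_lhs => rw [← List.ofFn_get L.anti]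
  exact congrArg List.ofFn (funext fun k => (ht.1 k).symm)

theorem IsTermOf.symm_eq {L : SPar} {m : ℕ} {hm : L.fdeg = m} {j : Fin m → Fin N}
    {μ : Fin N → ℕ} (ht : IsTermOf L hm j μ) : (L.symm : Multiset ℕ) =
      (((Finset.univ.filter fun i => ∀ k, j k ≠ i).val.map μ).filter (· ≠ 0)) := by
  subst hm
  exact ht.2.symm

theorem IsTermOf.unique {L M : SPar} {m : ℕ} {hL : L.fdeg = m} {hM : M.fdeg = m}
    {j : Fin m → Fin N} {μ : Fin N → ℕ} (h1 : IsTermOf L hL j μ) (h2 : IsTermOf M hM j μ) :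
    L = M := by
  refine SPar.ext (h1.anti_eq.trans h2.anti_eq.symm) ?_
  have h := Multiset.coe_eq_coe.1 (h1.symm_eq.trans h2.symm_eq.symm)
  exact h.eq_of_pairwise (fun a b _ _ h1 h2 => le_antisymm h2 h1) L.symm_sorted M.symm_sorted

/-- The superpartition is read off the monomial: the exponents at the θ-indices, then the sorted
nonzero exponents elsewhere. -/
theorem exists_isTermOf {n m : ℕ} {j : Fin m → Fin N} {μ : Fin N → ℕ}
    (hj : StrictAnti (μ ∘ j)) (hμ : ∑ i, μ i = n) :
    ∃ L : SParDeg n m, IsTermOf L.1 L.2.2 j μ := by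
  classical
  set t : Multiset ℕ :=
    ((Finset.univ.filter fun i => ∀ k, j k ≠ i).val.map μ).filter (· ≠ 0) with ht
  have hinj : Function.Injective j := fun a b hab => hj.injective (congrArg μ hab)
  let L : SPar :=
    { anti := List.ofFn (μ ∘ j)
      symm := t.sort (· ≥ ·)
      anti_sorted := List.pairwise_ofFn.2 fun a b hab => hj hab
      symm_sorted := t.pairwise_sort _
      symm_pos := fun a ha => by
        rw [Multiset.mem_sort, ht, Multiset.mem_filter] at ha
        exact Nat.pos_of_ne_zero ha.2 }
  have hf : L.fdeg = m := List.length_ofFn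
  have hd : L.deg = n := by
    change (List.ofFn (μ ∘ j)).sum + (t.sort (· ≥ ·)).sum = n
    have h0 : t.sum = ∑ i ∈ Finset.univ.filter (fun i => ∀ k, j k ≠ i), μ i := by
      have : ∀ s : Multiset ℕ, (s.filter (· ≠ 0)).sum = s.sum := fun s => by
        induction s using Multiset.induction_on with
        | empty => rfl
        | cons a s ih => by_cases h : a = 0 <;> simp_all
      rw [ht, this]; rfl
    rw [← Multiset.sum_coe (t.sort _), Multiset.sort_eq, h0, List.sum_ofFn, ← hμ,
      ← Finset.sum_filter_add_sum_filter_not Finset.univ (fun i => ∀ k, j k ≠ i) μ, add_comm]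
    congr 1
    have : (Finset.univ.filter fun i => ¬ ∀ k, j k ≠ i) = Finset.univ.image j := by
      ext i; simp
    rw [this, Finset.sum_image fun a _ b _ hab => hinj hab]
    rfl
  refine ⟨⟨L, hd, hf⟩, ?_, ?_⟩
  · intro k
    exact (List.get_ofFn (μ ∘ j) k).symm
  · change _ = ((t.sort (· ≥ ·) : List ℕ) : Multiset ℕ)
    rw [Multiset.sort_eq, ht]
    congr 3
    ext i
    simp only [Finset.mem_filter, Finset.mem_univ, true_and, Function.comp_apply]
    exact ⟨fun h k => by simpa using h (Fin.cast hf.symm k), fun h k => h _⟩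

/-- For `m ≤ 1` each monomial of degree `n` is a term of exactly one `m_Λ`, so a combination of the
`m_Λ` can be rewritten as a weighted sum over all monomials. -/
theorem sum_msym_val {n m : ℕ} (hm : m ≤ 1) (a : SPar → ℕ)
    (c : (Fin m → Fin N) → (Fin N → ℕ) → ℕ)
    (hc : ∀ (L : SPar) (hL : L.fdeg = m) j μ, IsTermOf L hL j μ → a L = c j μ) :
    (∑ L : SParDeg n m, a L.1 • msym R L.1 : SymRing R).1 N = weightSum R N n m c := by
  classical
  rw [AddSubmonoidClass.coe_finsetSum, Finset.sum_apply]
  have h1 : ∀ L : SParDeg n m, (a L.1 • msym R L.1 : SymRing R).1 N =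
      ∑ j : Fin m → Fin N, ∑ μ ∈ Finset.piAntidiag Finset.univ n,
        if IsTermOf L.1 L.2.2 j μ then c j μ • mono R j μ else 0 := fun L => by
    have : (a L.1 • msym R L.1 : SymRing R).1 N = a L.1 • (msym R L.1).1 N := rfl
    rw [this, msym_val R L.1 L.2.1 L.2.2, weightSum, Finset.smul_sum]
    refine Finset.sum_congr rfl fun j _ => ?_
    rw [Finset.smul_sum]
    refine Finset.sum_congr rfl fun μ _ => ?_
    split_ifs with h
    · rw [one_smul, hc _ _ _ _ h]
    · simp
  rw [Finset.sum_congr rfl fun L _ => h1 L, Finset.sum_comm, weightSum]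
  refine Finset.sum_congr rfl fun j _ => ?_
  rw [Finset.sum_comm]
  refine Finset.sum_congr rfl fun μ hμ => ?_
  -- This is where `m ≤ 1` enters: with at most one θ, strict decrease is vacuous.
  have hs : StrictAnti (μ ∘ j) := fun a b hab => absurd hab (by
    have := Fin.subsingleton_iff_le_one.2 hm
    rw [Subsingleton.elim a b]; exact lt_irrefl _)
  obtain ⟨L, hL⟩ := exists_isTermOf (n := n) hs (by simpa using hμ)
  rw [Finset.sum_eq_single L]
  · rw [if_pos hL]
  · intro M _ hM
    rw [if_neg fun h => hM (Subtype.ext (h.unique hL))]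
  · simp

theorem h_val (n : ℕ) : (h R n).1 N =
    evenPart R (PowerSeries.coeff n (weightSeries MvPolynomial.X fun _ _ => 1)) := by
  rw [← weightSum_zero R n (fun _ _ => 1) _ fun j μ => by simp,
    ← sum_msym_val R zero_le_one (fun _ => 1) _ fun _ _ _ _ _ => rfl]
  simp [h]

theorem ht_val (n : ℕ) : (ht R n).1 N = oddPart R fun k => PowerSeries.coeff n
    (weightSeries MvPolynomial.X (Function.update (fun _ _ => 1) k fun a => a + 1)) := by
  rw [← weightSum_one R n (fun j μ => μ (j 0) + 1),
    ← sum_msym_val R le_rfl (fun L => L.anti.headD 0 + 1)]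
  · rfl
  · intro L hL j μ h
    rw [h.anti_eq]
    simp
  · intro j μ
    rw [← Finset.mul_prod_erase _ _ (Finset.mem_univ (j 0)), Function.update_self]
    rw [Finset.prod_congr rfl fun i hi => by
      rw [Function.update_of_ne (Finset.ne_of_mem_erase hi)]]
    simp

end Values

/-! ### Relations between e, ẽ, h, h̃ and the odd power sums. -/

section Relations

variable (R : Type*) [CommRing R]

/-- The odd power sums `∑ i, x_i ^ n θ_i`. -/
def pt (n : ℕ) : SymRing R :=
  ∑ q ∈ Finset.HasAntidiagonal.antidiagonal n, (-1) ^ q.1 * (et R q.1 * h R q.2)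

theorem SymRing.ext {f g : SymRing R} (hfg : ∀ N, f.1 N = g.1 N) : f = g :=
  Subtype.ext (funext hfg)

theorem val_sum {α : Type*} (s : Finset α) (f : α → SymRing R) (N : ℕ) :
    (∑ i ∈ s, f i).1 N = ∑ i ∈ s, (f i).1 N := by
  rw [AddSubmonoidClass.coe_finsetSum, Finset.sum_apply]

theorem val_neg_one_pow (k N : ℕ) : ((-1) ^ k : SymRing R).1 N = (-1) ^ k := rfl

theorem val_mul (N : ℕ) (f g : SymRing R) : (f * g).1 N = f.1 N * g.1 N := rfl

theorem neg_one_pow_mul_oddPart {N : ℕ} (k : ℕ) (v : Fin N → MvPolynomial (Fin N) R) :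
    (-1) ^ k * oddPart R v = oddPart R fun i => (-1) ^ k * v i := by
  rw [← evenPart_mul_oddPart, map_pow, map_neg, map_one]

theorem oddPart_sum {N : ℕ} {α : Type*} (s : Finset α)
    (v : α → Fin N → MvPolynomial (Fin N) R) :
    ∑ a ∈ s, oddPart R (v a) = oddPart R fun i => ∑ a ∈ s, v a i := by
  rw [← map_sum]
  congr 1
  funext i
  exact Finset.sum_apply _ _ _

/-- Coefficient of `t^n` in Ẽ(-t) H(t) = ∑ θ_i / (1 - x_i t): at θ_i, all factors cancel except the
one of x_i, which Ẽ omits. -/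
theorem pt_val (n N : ℕ) : (pt R n).1 N = oddPart R fun i => MvPolynomial.X i ^ n := by
  rw [pt, val_sum]
  simp only [val_neg_one_pow, val_mul, et_val, h_val]
  simp only [← evenPart_commute, evenPart_mul_oddPart, neg_one_pow_mul_oddPart, oddPart_sum]
  congr 1
  funext i
  have := congrArg (PowerSeries.coeff n)
    (evalNegHom_update_mul_weight_one (MvPolynomial.X : _ → MvPolynomial (Fin N) R) i)
  rw [PowerSeries.coeff_mul, PowerSeries.coeff_mk, one_smul] at this
  rw [← this]
  refine Finset.sum_congr rfl fun q _ => ?_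
  rw [coeff_evalNegHom]
  ring

/-- In E(-t) H̃(t) the factor 1 - x_i t cancels one of the two poles of the θ_i-term, leaving the
same series as Ẽ(-t) H(t). -/
theorem sum_e_mul_ht (n : ℕ) :
    ∑ q ∈ Finset.HasAntidiagonal.antidiagonal n, (-1) ^ q.1 * (e R q.1 * ht R q.2) = pt R n := by
  refine SymRing.ext R fun N => ?_
  rw [pt_val, val_sum]
  simp only [val_neg_one_pow, val_mul, ht_val, e_val]
  simp only [evenPart_mul_oddPart, neg_one_pow_mul_oddPart, oddPart_sum]
  congr 1
  funext i
  have := congrArg (PowerSeries.coeff n)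
    (evalNegHom_weightE_mul_update (MvPolynomial.X : _ → MvPolynomial (Fin N) R) i)
  rw [PowerSeries.coeff_mul, PowerSeries.coeff_mk, one_smul] at this
  rw [← this]
  refine Finset.sum_congr rfl fun q _ => ?_
  rw [coeff_evalNegHom]
  ring

theorem sum_e_mul_h (n : ℕ) :
    ∑ q ∈ Finset.HasAntidiagonal.antidiagonal n, (-1) ^ q.1 * (e R q.1 * h R q.2) = if n = 0 then 1 else 0 := by
  refine SymRing.ext R fun N => ?_
  rw [val_sum]
  simp only [val_neg_one_pow, val_mul, h_val, e_val]
  have := congrArg (PowerSeries.coeff n)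
    (evalNegHom_weightE_mul_weight_one (MvPolynomial.X : _ → MvPolynomial (Fin N) R))
  rw [PowerSeries.coeff_mul, PowerSeries.coeff_one] at this
  have h2 := congrArg (evenPart R) this
  rw [map_sum] at h2
  have h3 : ((if n = 0 then 1 else 0 : SymRing R)).1 N =
      evenPart R (if n = 0 then (1 : MvPolynomial (Fin N) R) else 0) := by
    split_ifs
    · rw [map_one]; rfl
    · rw [map_zero]; rfl
  rw [h3, ← h2]
  refine Finset.sum_congr rfl fun q _ => ?_
  rw [coeff_evalNegHom, map_mul, map_mul, map_pow, map_neg, map_one, mul_assoc]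

theorem e_zero : e R 0 = 1 := by
  refine SymRing.ext R fun N => ?_
  rw [e_val, PowerSeries.coeff_zero_eq_constantCoeff_apply, weightSeries, map_prod]
  simp [weightE]

theorem h_zero : h R 0 = 1 := by
  simpa [e_zero] using sum_e_mul_h R 0

theorem e_commute (n : ℕ) (f : SymRing R) : Commute (e R n) f := by
  refine SymRing.ext R fun N => ?_
  rw [val_mul, val_mul, e_val, evenPart_commute]

theorem h_commute (n : ℕ) (f : SymRing R) : Commute (h R n) f := by
  refine SymRing.ext R fun N => ?_
  rw [val_mul, val_mul, h_val, evenPart_commute]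

theorem et_anticomm (n m : ℕ) : et R n * et R m = -(et R m * et R n) := by
  refine SymRing.ext R fun N => ?_
  have : ((-(et R m * et R n) : SymRing R)).1 N = -((et R m).1 N * (et R n).1 N) := rfl
  rw [this, val_mul, et_val, et_val]
  exact eq_neg_of_add_eq_zero_left (oddPart_mul_anticomm R _ _)

theorem ht_anticomm (n m : ℕ) : ht R n * ht R m = -(ht R m * ht R n) := by
  refine SymRing.ext R fun N => ?_
  have : ((-(ht R m * ht R n) : SymRing R)).1 N = -((ht R m).1 N * (ht R n).1 N) := rfl
  rw [this, val_mul, ht_val, ht_val]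
  exact eq_neg_of_add_eq_zero_left (oddPart_mul_anticomm R _ _)

theorem et_mul_self (n : ℕ) : et R n * et R n = 0 := by
  refine SymRing.ext R fun N => ?_
  rw [val_mul, et_val, oddPart_mul_self]
  rfl

theorem ht_mul_self (n : ℕ) : ht R n * ht R n = 0 := by
  refine SymRing.ext R fun N => ?_
  rw [val_mul, ht_val, oddPart_mul_self]
  rfl

end Relations

/-! ### Ordered products and the universal property. -/

section Products

/-- Sequences of even and odd elements of a ring. -/
structure IsSuperPair {S : Type*} [Ring S] (a b : ℕ → S) : Prop where
  even_zero : a 0 = 1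
  even_commute : ∀ n x, Commute (a n) x
  odd_anticomm : ∀ n k, b n * b k = -(b k * b n)
  odd_sq : ∀ n, b n * b n = 0

/-- The product `b_{Λ_1} ⋯ b_{Λ_m} a_{Λ_{m+1}} ⋯ a_{Λ_ℓ}`. -/
def superProd {S : Type*} [Ring S] (a b : ℕ → S) (L : SPar) : S :=
  (L.anti.map b).prod * (L.symm.map a).prod

/-- The empty superpartition. -/
def SPar.empty : SPar := ⟨[], [], List.Pairwise.nil, List.Pairwise.nil, by simp⟩

theorem superProd_empty {S : Type*} [Ring S] (a b : ℕ → S) : superProd a b SPar.empty = 1 := by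
  simp [superProd, SPar.empty]

/-- `M` is chosen before the ring and the pair, so one rule serves the e's and the h's alike; this
is what makes the linear map e_Λ ↦ h_Λ multiplicative. -/
theorem exists_even_mul_superProd (n : ℕ) (L : SPar) : ∃ M : SPar,
    ∀ {S : Type} [Ring S] {a b : ℕ → S}, IsSuperPair a b →
      a n * superProd a b L = superProd a b M := by
  rcases Nat.eq_zero_or_pos n with rfl | hn
  · exact ⟨L, fun h => by rw [h.even_zero, one_mul]⟩
  · refine ⟨⟨L.anti, L.symm.orderedInsert (· ≥ ·) n, L.anti_sorted,
      L.symm_sorted.orderedInsert _ _, fun x hx => ?_⟩, fun {S _ a b} h => ?_⟩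
    · rcases (List.mem_orderedInsert _).1 hx with rfl | hx
      · exact hn
      · exact L.symm_pos x hx
    · unfold superProd
      rw [← mul_assoc, (h.even_commute n _).eq, mul_assoc]
      congr 1
      have hp := (List.perm_orderedInsert (· ≥ ·) n L.symm).map a
      rw [hp.prod_eq']
      · simp
      · exact List.pairwise_of_forall_mem_list fun x hx y _ => by
          obtain ⟨k, _, rfl⟩ := List.mem_map.1 hx
          exact h.even_commute k y

/-- Move `b n` to its place in the decreasing list: each transposition costs a sign, and a repeated
index gives 0. The clause on the members of `l'` keeps the head of the list largest during the
induction. -/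
theorem exists_odd_mul_list_prod (n : ℕ) (l : List ℕ) (hl : l.Pairwise (· > ·)) :
    ∃ (ε : ℤ) (l' : List ℕ), l'.Pairwise (· > ·) ∧ (∀ x ∈ l', x = n ∨ x ∈ l) ∧
      ∀ {S : Type} [Ring S] {a b : ℕ → S}, IsSuperPair a b →
        b n * (l.map b).prod = (ε : S) * (l'.map b).prod := by
  induction l with
  | nil => exact ⟨1, [n], by simp, by simp, by simp⟩
  | cons c t ih =>
    rw [List.pairwise_cons] at hl
    rcases lt_trichotomy n c with hc | rfl | hc
    · obtain ⟨ε, t', h1, h2, h3⟩ := ih hl.2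
      refine ⟨-ε, c :: t', List.pairwise_cons.2 ⟨fun x hx => ?_, h1⟩, fun x hx => ?_,
        fun {S _ a b} h => ?_⟩
      · rcases h2 x hx with rfl | hx
        · exact hc
        · exact hl.1 x hx
      · rcases List.mem_cons.1 hx with rfl | hx
        · simp
        · rcases h2 x hx with rfl | hx <;> simp [*]
      · rw [List.map_cons, List.prod_cons, ← mul_assoc, h.odd_anticomm, neg_mul, mul_assoc, h3 h,
          List.map_cons, List.prod_cons, Int.cast_neg, neg_mul, ← mul_assoc, ← mul_assoc,
          (Int.cast_commute ε (b c)).eq]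
    · refine ⟨0, n :: t, List.pairwise_cons.2 hl, fun x hx => Or.inr hx, fun {S _ a b} h => ?_⟩
      rw [List.map_cons, List.prod_cons, ← mul_assoc, h.odd_sq, zero_mul, Int.cast_zero, zero_mul]
    · refine ⟨1, n :: c :: t, List.pairwise_cons.2 ⟨fun x hx => ?_, List.pairwise_cons.2 hl⟩,
        fun x hx => List.mem_cons.1 hx, fun h => by simp⟩
      rcases List.mem_cons.1 hx with rfl | hx
      · exact hc
      · exact lt_trans (hl.1 x hx) hc

theorem exists_odd_mul_superProd (n : ℕ) (L : SPar) : ∃ (ε : ℤ) (M : SPar),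
    ∀ {S : Type} [Ring S] {a b : ℕ → S}, IsSuperPair a b →
      b n * superProd a b L = (ε : S) * superProd a b M := by
  obtain ⟨ε, l, h1, -, h3⟩ := exists_odd_mul_list_prod n L.anti L.anti_sorted
  refine ⟨ε, ⟨l, L.symm, h1, L.symm_sorted, L.symm_pos⟩, fun h => ?_⟩
  rw [superProd, ← mul_assoc, h3 h, mul_assoc]
  rfl

theorem intCast_mul_eq_smul (k : Type*) {S : Type*} [CommRing k] [Ring S] [Algebra k S]
    (ε : ℤ) (x : S) : (ε : S) * x = (ε : k) • x := by
  rw [Algebra.smul_def, map_intCast]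

variable {k : Type*} {S : Type} [CommRing k] [Ring S] [Algebra k S] {a b : ℕ → S}

/-- The span of the ordered products contains 1 and is stable under left multiplication by the
generators, hence by all they generate. -/
theorem IsSuperPair.mem_span_of_mem_adjoin (hab : IsSuperPair a b) {x : S}
    (hx : x ∈ Algebra.adjoin k (Set.range a ∪ Set.range b)) :
    x ∈ Submodule.span k (Set.range (superProd a b)) := by
  set V := Submodule.span k (Set.range (superProd a b)) with hV
  suffices h : ∀ v ∈ V, x * v ∈ V by
    simpa using h 1 (Submodule.subset_span ⟨SPar.empty, superProd_empty a b⟩)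
  have key : ∀ y : S, (∀ L, y * superProd a b L ∈ V) → ∀ v ∈ V, y * v ∈ V := by
    intro y hy v hv
    induction hv using Submodule.span_induction with
    | mem v hv => obtain ⟨L, rfl⟩ := hv; exact hy L
    | zero => rw [mul_zero]; exact zero_mem _
    | add u v _ _ hu hv => rw [mul_add]; exact add_mem hu hv
    | smul c v _ hv => rw [mul_smul_comm]; exact Submodule.smul_mem _ c hv
  induction hx using Algebra.adjoin_induction with
  | mem y hy =>
    rcases hy with ⟨n, rfl⟩ | ⟨n, rfl⟩
    · refine key _ fun L => ?_
      obtain ⟨M, hM⟩ := exists_even_mul_superProd n L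
      rw [hM hab]
      exact Submodule.subset_span ⟨M, rfl⟩
    · refine key _ fun L => ?_
      obtain ⟨ε, M, hM⟩ := exists_odd_mul_superProd n L
      rw [hM hab, intCast_mul_eq_smul k]
      exact Submodule.smul_mem _ _ (Submodule.subset_span ⟨M, rfl⟩)
  | algebraMap r =>
    intro v hv
    rw [← Algebra.smul_def]
    exact Submodule.smul_mem _ r hv
  | add x y _ _ hx hy => intro v hv; rw [add_mul]; exact add_mem (hx v hv) (hy v hv)
  | mul x y _ _ hx hy => intro v hv; rw [mul_assoc]; exact hx _ (hy v hv)

theorem superProd_mem_adjoin (L : SPar) :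
    superProd a b L ∈ Algebra.adjoin k (Set.range a ∪ Set.range b) := by
  refine mul_mem (list_prod_mem fun x hx => ?_) (list_prod_mem fun x hx => ?_)
  · obtain ⟨i, _, rfl⟩ := List.mem_map.1 hx
    exact Algebra.subset_adjoin (Or.inr ⟨i, rfl⟩)
  · obtain ⟨i, _, rfl⟩ := List.mem_map.1 hx
    exact Algebra.subset_adjoin (Or.inl ⟨i, rfl⟩)

theorem adjoin_eq_top_of_basis (B : Module.Basis SPar k S) (hB : ∀ L, B L = superProd a b L) :
    Algebra.adjoin k (Set.range a ∪ Set.range b) = ⊤ := by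
  rw [← Algebra.toSubmodule_eq_top, ← top_le_iff, ← B.span_eq, Submodule.span_le]
  rintro _ ⟨L, rfl⟩
  rw [hB]
  exact superProd_mem_adjoin L

theorem map_superProd {S T : Type*} [Ring S] [Ring T] {a b : ℕ → S} (f : S →+* T) (L : SPar) :
    f (superProd a b L) = superProd (f ∘ a) (f ∘ b) L := by
  simp [superProd, map_list_prod, List.map_map]

/-- A superpair whose ordered products form a basis is universal. -/
theorem IsSuperPair.exists_algHom (hab : IsSuperPair a b) (B : Module.Basis SPar k S)
    (hB : ∀ L, B L = superProd a b L) {T : Type} [Ring T] [Algebra k T] {a' b' : ℕ → T}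
    (hab' : IsSuperPair a' b') :
    ∃ f : S →ₐ[k] T, (∀ n, f (a n) = a' n) ∧ ∀ n, f (b n) = b' n := by
  set φ : S →ₗ[k] T := B.constr k (superProd a' b') with hφ
  have hφB : ∀ L, φ (superProd a b L) = superProd a' b' L := fun L => by
    rw [← hB, hφ, Module.Basis.constr_basis]
  have h1 : φ 1 = 1 := by
    rw [← superProd_empty a b, hφB, superProd_empty]
  -- Compatibility with a left multiplication may be tested on the basis; the rules for generators
  -- settle that case, and induction over the generated algebra then gives all products.
  have hlin : ∀ (y : S) (z : T), (∀ L, φ (y * superProd a b L) = z * superProd a' b' L) →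
      ∀ x, φ (y * x) = z * φ x := by
    intro y z hyz x
    have : φ.comp (LinearMap.mulLeft k y) = (LinearMap.mulLeft k z).comp φ := by
      refine B.ext fun L => ?_
      simp [hB, hyz, hφB]
    exact LinearMap.congr_fun this x
  have ha : ∀ n x, φ (a n * x) = a' n * φ x := fun n => hlin _ _ fun L => by
    obtain ⟨M, hM⟩ := exists_even_mul_superProd n L
    rw [hM hab, hφB, hM hab']
  have hb : ∀ n x, φ (b n * x) = b' n * φ x := fun n => hlin _ _ fun L => by
    obtain ⟨ε, M, hM⟩ := exists_odd_mul_superProd n L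
    rw [hM hab, intCast_mul_eq_smul k, map_smul, hφB, hM hab', intCast_mul_eq_smul k]
  have ha1 : ∀ n, φ (a n) = a' n := fun n => by simpa [h1] using ha n 1
  have hb1 : ∀ n, φ (b n) = b' n := fun n => by simpa [h1] using hb n 1
  have hmul : ∀ x y, φ (x * y) = φ x * φ y := by
    intro x
    have hx : x ∈ Algebra.adjoin k (Set.range a ∪ Set.range b) := by
      rw [adjoin_eq_top_of_basis B hB]; trivial
    induction hx using Algebra.adjoin_induction with
    | mem x hx =>
      rcases hx with ⟨n, rfl⟩ | ⟨n, rfl⟩ <;> intro y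
      · rw [ha, ha1]
      · rw [hb, hb1]
    | algebraMap r =>
      intro y
      rw [← Algebra.smul_def, map_smul, Algebra.algebraMap_eq_smul_one, map_smul, h1,
        smul_mul_assoc, one_mul]
    | add x z _ _ hx hz => intro y; rw [add_mul, map_add, hx, hz, map_add, add_mul]
    | mul x z _ _ hx hz => intro y; rw [mul_assoc, hx, hz, hx, mul_assoc]
  exact ⟨AlgHom.ofLinearMap φ h1 hmul, ha1, hb1⟩

variable (R : Type*) [CommRing R]

theorem isSuperPair_e : IsSuperPair (e R) (et R) :=
  ⟨e_zero R, e_commute R, et_anticomm R, et_mul_self R⟩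

theorem isSuperPair_h : IsSuperPair (h R) (ht R) :=
  ⟨h_zero R, h_commute R, ht_anticomm R, ht_mul_self R⟩

theorem eProd_eq (L : SPar) : eProd R L = superProd (e R) (et R) L := rfl

end Products

/-! ### Coefficients of θ-monomials as minors. -/

section Minors

variable (R : Type*) [CommRing R] {N : ℕ}

theorem linearMap_ext_tmul_ιMulti {V : Type*} [AddCommGroup V] [Module R V]
    {f g : SuperPoly R N →ₗ[R] V}
    (hfg : ∀ p k (u : Fin k → Fin N → R),
      f (p ⊗ₜ[R] ExteriorAlgebra.ιMulti R k u) = g (p ⊗ₜ[R] ExteriorAlgebra.ιMulti R k u)) :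
    f = g := by
  refine TensorProduct.ext' fun p w => ?_
  have : f.comp (TensorProduct.mk R _ _ p) = g.comp (TensorProduct.mk R _ _ p) := by
    refine ExteriorAlgebra.lhom_ext fun k => AlternatingMap.ext fun u => ?_
    exact hfg p k u
  exact LinearMap.congr_fun this w

/-- Extension of scalars to the polynomial ring on the exterior algebra. -/
def scalarExtension : ExteriorAlgebra R (Fin N → R) →ₐ[R]
    ExteriorAlgebra (MvPolynomial (Fin N) R) (Fin N → MvPolynomial (Fin N) R) :=
  ExteriorAlgebra.lift R
    ⟨((ExteriorAlgebra.ι (MvPolynomial (Fin N) R)).restrictScalars R).comp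
      ((Algebra.linearMap R (MvPolynomial (Fin N) R)).compLeft (Fin N)), fun v => by simp⟩

theorem scalarExtension_ι (v : Fin N → R) : scalarExtension R (ExteriorAlgebra.ι R v) =
    ExteriorAlgebra.ι (MvPolynomial (Fin N) R) fun i => MvPolynomial.C (v i) := by
  rw [scalarExtension, ExteriorAlgebra.lift_ι_apply]
  rfl

/-- Superpolynomials as elements of the exterior algebra over the polynomial ring. -/
def toExterior : SuperPoly R N →ₐ[R]
    ExteriorAlgebra (MvPolynomial (Fin N) R) (Fin N → MvPolynomial (Fin N) R) :=
  Algebra.TensorProduct.lift (IsScalarTower.toAlgHom R (MvPolynomial (Fin N) R) _)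
    (scalarExtension R) fun p w => by
      rw [IsScalarTower.coe_toAlgHom']
      exact Algebra.commutes p _

theorem toExterior_tmul (p : MvPolynomial (Fin N) R) (w : ExteriorAlgebra R (Fin N → R)) :
    toExterior R (p ⊗ₜ[R] w) = p • scalarExtension R w := by
  rw [toExterior, Algebra.TensorProduct.lift_tmul, Algebra.smul_def]
  rfl

theorem toExterior_tmul_ιMulti (p : MvPolynomial (Fin N) R) (k : ℕ) (u : Fin k → Fin N → R) :
    toExterior R (p ⊗ₜ[R] ExteriorAlgebra.ιMulti R k u) =
      p • ExteriorAlgebra.ιMulti (MvPolynomial (Fin N) R) k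
        fun l i => MvPolynomial.C (u l i) := by
  rw [toExterior_tmul, ExteriorAlgebra.ιMulti_apply, ExteriorAlgebra.ιMulti_apply, map_list_prod,
    List.map_ofFn]
  congr 3
  funext l
  exact scalarExtension_ι R (u l)

theorem toExterior_evenPart (p : MvPolynomial (Fin N) R) :
    toExterior R (evenPart R p) = algebraMap _ _ p := by
  rw [evenPart_apply, toExterior_tmul, map_one, Algebra.algebraMap_eq_smul_one]

theorem toExterior_oddPart (v : Fin N → MvPolynomial (Fin N) R) :
    toExterior R (oddPart R v) = ExteriorAlgebra.ι _ v := by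
  rw [oddPart_apply, map_sum]
  have : ∀ i, toExterior R (v i ⊗ₜ[R] ExteriorAlgebra.ι R (Pi.single i (1 : R))) =
      v i • ExteriorAlgebra.ι _ (Pi.single i (1 : MvPolynomial (Fin N) R)) := fun i => by
    rw [toExterior_tmul, scalarExtension_ι]
    congr 2
    funext k
    by_cases hk : k = i
    · subst hk; simp
    · simp [hk]
  rw [Finset.sum_congr rfl fun i _ => this i]
  simp only [← map_smul, ← map_sum]
  congr 1
  funext k
  simp [Finset.sum_apply, Pi.single_apply]

/-- The minor in the columns `j`. -/
def minorMap {m : ℕ} (j : Fin m → Fin N) :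
    (Fin N → MvPolynomial (Fin N) R) [⋀^Fin m]→ₗ[MvPolynomial (Fin N) R] MvPolynomial (Fin N) R :=
  Matrix.detRowAlternating.compLinearMap (LinearMap.funLeft _ _ j)

theorem minorMap_apply {m : ℕ} (j : Fin m → Fin N) (v : Fin m → Fin N → MvPolynomial (Fin N) R) :
    minorMap R j v = (Matrix.of fun l r => v l (j r)).det := rfl

/-- The coefficient of `θ_{j 0} ⋯ θ_{j (m-1)}` in a superpolynomial. -/
def thetaCoeff {m : ℕ} (j : Fin m → Fin N) : SuperPoly R N →ₗ[R] MvPolynomial (Fin N) R :=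
  ((ExteriorAlgebra.liftAlternating (Pi.single m (minorMap R j))).restrictScalars R).comp
    (toExterior R).toLinearMap

theorem thetaCoeff_tmul_ιMulti {m : ℕ} (j : Fin m → Fin N) (p : MvPolynomial (Fin N) R)
    (u : Fin m → Fin N → R) : thetaCoeff R j (p ⊗ₜ[R] ExteriorAlgebra.ιMulti R m u) =
      p * MvPolynomial.C (Matrix.of fun l r => u l (j r)).det := by
  have h0 := toExterior_tmul_ιMulti R p m u
  simp only [thetaCoeff, LinearMap.comp_apply, AlgHom.toLinearMap_apply, h0,
    LinearMap.restrictScalars_apply, map_smul, ExteriorAlgebra.liftAlternating_apply_ιMulti,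
    Pi.single_eq_same, minorMap_apply, smul_eq_mul, RingHom.map_det]
  rfl

theorem thetaCoeff_tmul_ιMulti_of_ne {m k : ℕ} (hk : k ≠ m) (j : Fin m → Fin N)
    (p : MvPolynomial (Fin N) R) (u : Fin k → Fin N → R) :
    thetaCoeff R j (p ⊗ₜ[R] ExteriorAlgebra.ιMulti R k u) = 0 := by
  have h0 := toExterior_tmul_ιMulti R p k u
  simp only [thetaCoeff, LinearMap.comp_apply, AlgHom.toLinearMap_apply, h0,
    LinearMap.restrictScalars_apply, map_smul, ExteriorAlgebra.liftAlternating_apply_ιMulti,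
    Pi.single_eq_of_ne hk, AlternatingMap.zero_apply, smul_zero]

/-- Over the polynomial ring a product of odd elements is a wedge of vectors, whose coordinates are
minors. The passage to the exterior algebra over that ring serves this computation. -/
theorem thetaCoeff_prod_oddPart {m : ℕ} (j : Fin m → Fin N)
    (v : Fin m → Fin N → MvPolynomial (Fin N) R) (q : MvPolynomial (Fin N) R) :
    thetaCoeff R j ((List.ofFn fun l => oddPart R (v l)).prod * evenPart R q) =
      (Matrix.of fun l r => v l (j r)).det * q := by
  have : toExterior R ((List.ofFn fun l => oddPart R (v l)).prod * evenPart R q) =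
      q • ExteriorAlgebra.ιMulti _ m v := by
    rw [map_mul, toExterior_evenPart, ← Algebra.commutes, ← Algebra.smul_def, map_list_prod,
      List.map_ofFn, ExteriorAlgebra.ιMulti_apply]
    congr 3
    funext l
    exact toExterior_oddPart R (v l)
  simp only [thetaCoeff, LinearMap.comp_apply, AlgHom.toLinearMap_apply, this,
    LinearMap.restrictScalars_apply, map_smul, ExteriorAlgebra.liftAlternating_apply_ιMulti,
    Pi.single_eq_same, minorMap_apply, smul_eq_mul, mul_comm]

theorem thetaCoeff_permute {m : ℕ} (σ : Equiv.Perm (Fin N)) (j : Fin m → Fin N)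
    (f : SuperPoly R N) :
    thetaCoeff R (σ ∘ j) (permute R σ f) = MvPolynomial.rename σ (thetaCoeff R j f) := by
  have : (thetaCoeff R (σ ∘ j)).comp (permute R σ).toLinearMap =
      (MvPolynomial.rename σ).toLinearMap.comp (thetaCoeff R j) := by
    refine linearMap_ext_tmul_ιMulti R fun p k u => ?_
    simp only [LinearMap.comp_apply, AlgHom.toLinearMap_apply, permute,
      Algebra.TensorProduct.map_tmul, ExteriorAlgebra.map_apply_ιMulti]
    by_cases hk : k = m
    · subst hk
      rw [thetaCoeff_tmul_ιMulti, thetaCoeff_tmul_ιMulti, map_mul, MvPolynomial.rename_C]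
      congr 3
      ext l r
      simp [LinearMap.funLeft_apply]
    · rw [thetaCoeff_tmul_ιMulti_of_ne R hk, thetaCoeff_tmul_ιMulti_of_ne R hk, map_zero]
  exact LinearMap.congr_fun this f

theorem thetaCoeff_restrict {m : ℕ} (j : Fin m → Fin N) (f : SuperPoly R (N + 1)) :
    thetaCoeff R j (restrict R N f) =
      MvPolynomial.aeval (Fin.lastCases (0 : MvPolynomial (Fin N) R) MvPolynomial.X)
        (thetaCoeff R (Fin.castSucc ∘ j) f) := by
  have : (thetaCoeff R j).comp (restrict R N).toLinearMap =
      (MvPolynomial.aeval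
        (Fin.lastCases (0 : MvPolynomial (Fin N) R) MvPolynomial.X)).toLinearMap.comp
        (thetaCoeff R (Fin.castSucc ∘ j)) := by
    refine linearMap_ext_tmul_ιMulti R fun p k u => ?_
    simp only [LinearMap.comp_apply, AlgHom.toLinearMap_apply, restrict,
      Algebra.TensorProduct.map_tmul, ExteriorAlgebra.map_apply_ιMulti]
    by_cases hk : k = m
    · subst hk
      rw [thetaCoeff_tmul_ιMulti, thetaCoeff_tmul_ιMulti, map_mul, MvPolynomial.aeval_C]
      rfl
    · rw [thetaCoeff_tmul_ιMulti_of_ne R hk, thetaCoeff_tmul_ιMulti_of_ne R hk, map_zero]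
  exact LinearMap.congr_fun this f

theorem thetaCoeff_comp_perm {m : ℕ} (τ : Equiv.Perm (Fin m)) (j : Fin m → Fin N)
    (f : SuperPoly R N) :
    thetaCoeff R (j ∘ τ) f = (Equiv.Perm.sign τ : ℤ) • thetaCoeff R j f := by
  have : thetaCoeff R (j ∘ τ) = (Equiv.Perm.sign τ : ℤ) • thetaCoeff R j := by
    refine linearMap_ext_tmul_ιMulti R fun p k u => ?_
    rw [LinearMap.smul_apply]
    by_cases hk : k = m
    · subst hk
      rw [thetaCoeff_tmul_ιMulti, thetaCoeff_tmul_ιMulti, zsmul_eq_mul, mul_left_comm]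
      congr 1
      have := Matrix.det_permute' τ (Matrix.of fun l r => u l (j r))
      change MvPolynomial.C ((Matrix.of fun l r => u l (j r)).submatrix id τ).det = _
      rw [this]
      simp
    · rw [thetaCoeff_tmul_ιMulti_of_ne R hk, thetaCoeff_tmul_ιMulti_of_ne R hk, smul_zero]
  rw [this, LinearMap.smul_apply]

/-- The coefficients at increasing `j` are the coordinates in the standard basis of the exterior
power. -/
theorem eq_zero_of_thetaCoeff_eq_zero {n m : ℕ} {f : SuperPoly R N} (hf : f ∈ homog R N n m)
    (h0 : ∀ j : Fin m → Fin N, Function.Injective j → thetaCoeff R j f = 0) : f = 0 := by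
  let b := Pi.basisFun R (Fin N)
  let js : Set.powersetCard (Fin N) m → Fin m → Fin N :=
    fun s => Set.powersetCard.ofFinEmbEquiv.symm s
  have key : ∀ p (w : ⋀[R]^m (Fin N → R)) s,
      thetaCoeff R (js s) (p ⊗ₜ[R] (w : ExteriorAlgebra R (Fin N → R))) =
        exteriorPower.ιMultiDual R m b s w • p := by
    intro p w s
    have : (thetaCoeff R (js s)).comp ((TensorProduct.mk R _ _ p).comp
        (Submodule.subtype (⋀[R]^m (Fin N → R)))) =
        (LinearMap.toSpanSingleton R _ p).comp (exteriorPower.ιMultiDual R m b s) := by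
      refine exteriorPower.linearMap_ext (AlternatingMap.ext fun u => ?_)
      have h1 := thetaCoeff_tmul_ιMulti R (js s) p u
      have h2 := exteriorPower.ιMultiDual_apply_ιMulti R m b s u
      simp only [LinearMap.compAlternatingMap_apply, LinearMap.comp_apply,
        LinearMap.toSpanSingleton_apply, h2, MvPolynomial.smul_eq_C_mul]
      exact h1.trans (mul_comm _ _)
    exact LinearMap.congr_fun this w
  have hsum : f = ∑ s, thetaCoeff R (js s) f ⊗ₜ[R]
      (b.exteriorPower m s : ExteriorAlgebra R (Fin N → R)) := by
    clear h0
    unfold homog at hf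
    induction hf using Submodule.span_induction with
    | mem f hf =>
      obtain ⟨p, -, w, hw, rfl⟩ := hf
      have h1 := (b.exteriorPower m).sum_repr ⟨w, hw⟩
      have h2 := congrArg (Submodule.subtype _) h1
      rw [map_sum] at h2
      simp only [Submodule.subtype_apply, Submodule.coe_smul] at h2
      conv_lhs => rw [← h2, TensorProduct.tmul_sum]
      refine Finset.sum_congr rfl fun s _ => ?_
      rw [key p ⟨w, hw⟩ s, exteriorPower.basis_repr_apply, TensorProduct.tmul_smul,
        TensorProduct.smul_tmul']
    | zero => simp
    | add f g _ _ hf hg =>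
      simp only [map_add, TensorProduct.add_tmul, Finset.sum_add_distrib]
      rw [← hf, ← hg]
    | smul c f _ hf =>
      simp only [map_smul, ← TensorProduct.smul_tmul', ← Finset.smul_sum]
      rw [← hf]
  rw [hsum]
  refine Finset.sum_eq_zero fun s _ => ?_
  rw [h0 _ (Set.powersetCard.ofFinEmbEquiv.symm s).injective, TensorProduct.zero_tmul]

theorem thetaCoeff_isHomogeneous {n m : ℕ} {f : SuperPoly R N} (hf : f ∈ homog R N n m)
    (j : Fin m → Fin N) : (thetaCoeff R j f).IsHomogeneous n := by
  rw [← MvPolynomial.mem_homogeneousSubmodule]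
  unfold homog at hf
  induction hf using Submodule.span_induction with
  | mem f hf =>
    obtain ⟨p, hp, w, hw, rfl⟩ := hf
    rw [← exteriorPower.ιMulti_span_fixedDegree] at hw
    induction hw using Submodule.span_induction with
    | mem w hw =>
      obtain ⟨u, rfl⟩ := hw
      rw [thetaCoeff_tmul_ιMulti, mul_comm, ← MvPolynomial.smul_eq_C_mul]
      exact Submodule.smul_mem _ _ hp
    | zero => rw [TensorProduct.tmul_zero, map_zero]; exact zero_mem _
    | add f g _ _ hf hg => rw [TensorProduct.tmul_add, map_add]; exact add_mem hf hg
    | smul c f _ hf =>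
      rw [TensorProduct.tmul_smul, map_smul]; exact Submodule.smul_mem _ c hf
  | zero => rw [map_zero]; exact zero_mem _
  | add f g _ _ hf hg => rw [map_add]; exact add_mem hf hg
  | smul c f _ hf => rw [map_smul]; exact Submodule.smul_mem _ c hf

/-- Setting the last variable to zero does not touch monomials free of it. -/
theorem coeff_aeval_lastCases (p : MvPolynomial (Fin (N + 1)) R) (ν : Fin (N + 1) →₀ ℕ)
    (hν : ν (Fin.last N) = 0) :
    MvPolynomial.coeff (Finsupp.equivFunOnFinite.symm fun i : Fin N => ν i.castSucc)
      (MvPolynomial.aeval (Fin.lastCases (0 : MvPolynomial (Fin N) R) MvPolynomial.X) p) =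
      MvPolynomial.coeff ν p := by
  classical
  induction p using MvPolynomial.induction_on' with
  | monomial ρ c =>
    rw [MvPolynomial.aeval_monomial, Finsupp.prod_fintype _ _ (fun i => pow_zero _),
      Fin.prod_univ_castSucc]
    simp only [Fin.lastCases_castSucc, Fin.lastCases_last, MvPolynomial.algebraMap_eq]
    rw [MvPolynomial.coeff_monomial]
    by_cases hρ : ρ (Fin.last N) = 0
    · have h1 : (∏ i : Fin N, (MvPolynomial.X i : MvPolynomial (Fin N) R) ^ ρ i.castSucc) =
          MvPolynomial.monomial (Finsupp.equivFunOnFinite.symm fun i : Fin N => ρ i.castSucc) 1 := by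
        rw [MvPolynomial.monomial_eq, Finsupp.prod_fintype _ _ (fun i => pow_zero _)]
        simp
      rw [hρ, pow_zero, mul_one, h1, MvPolynomial.C_mul_monomial, mul_one,
        MvPolynomial.coeff_monomial]
      refine if_congr ⟨fun h => ?_, fun h => by rw [h]⟩ rfl rfl
      ext i
      refine Fin.lastCases ?_ (fun i => ?_) i
      · rw [hρ, hν]
      · exact DFunLike.congr_fun h i
    · rw [zero_pow hρ, mul_zero, mul_zero, MvPolynomial.coeff_zero, if_neg]
      rintro rfl
      exact hρ hν
  | add p q hp hq => rw [map_add, MvPolynomial.coeff_add, hp, hq, MvPolynomial.coeff_add]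

end Minors

/-! ### A single coefficient in n + m variables determines the superfunction. -/

section Families

variable (R : Type*) [CommRing R]

variable {R} {n m : ℕ} {f : ∀ N, SuperPoly R N}

theorem rename_thetaCoeff (hf : f ∈ familyDeg R n m) {N : ℕ} (σ : Equiv.Perm (Fin N))
    (j : Fin m → Fin N) :
    MvPolynomial.rename σ (thetaCoeff R j (f N)) = thetaCoeff R (σ ∘ j) (f N) := by
  rw [← thetaCoeff_permute, hf.1 N σ]

/-- Permutations act transitively on injective index tuples, so by symmetry one coefficient controls
all others. -/
theorem apply_eq_zero_of_thetaCoeff (hf : f ∈ familyDeg R n m) {N : ℕ} {j : Fin m → Fin N}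
    (hj : Function.Injective j) (h0 : thetaCoeff R j (f N) = 0) : f N = 0 := by
  refine eq_zero_of_thetaCoeff_eq_zero R (hf.2.2 N) fun j' hj' => ?_
  obtain ⟨σ, hσ⟩ : ∃ σ : Equiv.Perm (Fin N), σ ∘ j = j' := by
    let e1 := Equiv.ofInjective j hj
    let e2 := Equiv.ofInjective j' hj'
    refine ⟨(e1.symm.trans e2).extendSubtype, funext fun k => ?_⟩
    have hk : j k ∈ Set.range j := ⟨k, rfl⟩
    have := Equiv.extendSubtype_apply_of_mem (e1.symm.trans e2) (j k) hk
    rw [Function.comp_apply, this]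
    have h2 : e1.symm ⟨j k, hk⟩ = k := by
      rw [Equiv.symm_apply_eq]; rfl
    rw [Equiv.trans_apply, h2]
    rfl
  rw [← hσ, ← rename_thetaCoeff hf, h0, map_zero]

theorem apply_succ_eq_zero (hf : f ∈ familyDeg R n m) {N : ℕ} (hN : n + m ≤ N) (h0 : f N = 0) :
    f (N + 1) = 0 := by
  refine eq_zero_of_thetaCoeff_eq_zero R (hf.2.2 (N + 1)) fun j _ => ?_
  ext μ
  rw [MvPolynomial.coeff_zero]
  by_contra hμ
  have hdeg := thetaCoeff_isHomogeneous R (hf.2.2 (N + 1)) j hμ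
  -- The monomial involves at most `n` of the x's and `m` of the θ's, and there are more than `n +
  -- m` indices.
  have hex : ∃ i, i ∉ μ.support ∪ Finset.univ.image j := by
    by_contra! hall
    have h1 := Finset.card_le_card (fun i _ => hall i : Finset.univ ⊆ _)
    have h2 := Finset.card_union_le μ.support (Finset.univ.image j)
    have h3 : (Finset.univ.image j).card ≤ m := by
      simpa using Finset.card_image_le (s := Finset.univ) (f := j)
    have h4 : μ.support.card ≤ n := by
      rw [← hdeg, Finsupp.weight_apply, Finsupp.sum, Finset.card_eq_sum_ones]
      refine Finset.sum_le_sum fun i hi => ?_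
      have := Finsupp.mem_support_iff.1 hi
      simp; omega
    rw [Finset.card_univ, Fintype.card_fin] at h1
    omega
  obtain ⟨i, hi⟩ := hex
  simp only [Finset.mem_union, Finsupp.mem_support_iff, Finset.mem_image, Finset.mem_univ,
    true_and, not_or, not_not, not_exists] at hi
  -- Moving the unused index to the end makes the coefficient visible after restriction to `N`
  -- variables, where it vanishes.
  let σ := Equiv.swap i (Fin.last N)
  have h1 : MvPolynomial.coeff (Finsupp.mapDomain σ μ) (thetaCoeff R (σ ∘ j) (f (N + 1))) ≠ 0 := by
    rw [← rename_thetaCoeff hf, MvPolynomial.coeff_rename_mapDomain _ σ.injective]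
    exact hμ
  have h2 : Finsupp.mapDomain σ μ (Fin.last N) = 0 := by
    rw [← Equiv.swap_apply_left i (Fin.last N)]
    exact (Finsupp.mapDomain_apply σ.injective μ i).trans hi.1
  have h3 : ∀ k, (σ ∘ j) k ≠ Fin.last N := fun k hk => by
    rw [← Equiv.swap_apply_left i (Fin.last N)] at hk
    exact hi.2 k (σ.injective hk)
  obtain ⟨j', hj'⟩ : ∃ j' : Fin m → Fin N, σ ∘ j = Fin.castSucc ∘ j' :=
    ⟨fun k => ((σ ∘ j) k).castPred (h3 k), by funext k; simp⟩
  apply h1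
  rw [hj', ← coeff_aeval_lastCases R _ _ h2, ← thetaCoeff_restrict, hf.2.1 N, h0, map_zero,
    MvPolynomial.coeff_zero]

theorem eq_zero_of_apply_eq_zero (hf : f ∈ familyDeg R n m) {N : ℕ} (hN : n + m ≤ N)
    (h0 : f N = 0) : f = 0 := by
  funext M
  rcases le_total N M with h | h
  · induction M, h using Nat.le_induction with
    | base => exact h0
    | succ M hM ih => exact apply_succ_eq_zero hf (hN.trans hM) ih
  · clear hN
    induction N, h using Nat.le_induction with
    | base => exact h0
    | succ K _ ih => exact ih (by rw [← hf.2.1 K, h0]; exact map_zero _)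

end Families

/-! ### Lexicographic leading terms. -/

section LeadingTerms

variable {σ : Type*} [LinearOrder σ] {k : Type*} [CommRing k]

/-- `d` is the largest exponent of `p` in the lexicographic order. -/
def IsTopExp (p : MvPolynomial σ k) (d : σ →₀ ℕ) : Prop :=
  MvPolynomial.coeff d p ≠ 0 ∧ ∀ d', MvPolynomial.coeff d' p ≠ 0 → toLex d' ≤ toLex d

/-- `p` has leading monomial `x^d`, with coefficient one, in the lexicographic order. -/
def IsLead (p : MvPolynomial σ k) (d : σ →₀ ℕ) : Prop :=
  MvPolynomial.coeff d p = 1 ∧ ∀ d', MvPolynomial.coeff d' p ≠ 0 → toLex d' ≤ toLex d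

theorem exists_isTopExp {p : MvPolynomial σ k} (hp : p ≠ 0) : ∃ d, IsTopExp p d := by
  obtain ⟨d, hd, hmax⟩ := Finset.exists_max_image p.support toLex
    (MvPolynomial.support_nonempty.2 hp)
  exact ⟨d, MvPolynomial.mem_support_iff.1 hd,
    fun d' hd' => hmax d' (MvPolynomial.mem_support_iff.2 hd')⟩

theorem IsLead.mul {p q : MvPolynomial σ k} {c d : σ →₀ ℕ} (hp : IsLead p c) (hq : IsLead q d) :
    IsLead (p * q) (c + d) := by
  classical
  refine ⟨?_, fun d' hd' => ?_⟩
  · rw [MvPolynomial.coeff_mul, Finset.sum_eq_single (c, d)]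
    · rw [hp.1, hq.1, one_mul]
    · rintro ⟨a, b⟩ hab hne
      by_contra h
      have ha := hp.2 a (left_ne_zero_of_mul h)
      have hb := hq.2 b (right_ne_zero_of_mul h)
      have hab' : toLex a + toLex b = toLex c + toLex d := by
        rw [← toLex_add, ← toLex_add, Finset.HasAntidiagonal.mem_antidiagonal.1 hab]
      have h1 : toLex a = toLex c := by
        refine le_antisymm ha (not_lt.1 fun hlt => ?_)
        exact absurd hab' (add_lt_add_of_lt_of_le hlt hb).ne
      rw [h1] at hab'
      have h2 := add_left_cancel hab'
      have h3 : a = c := toLex.injective h1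
      have h4 : b = d := toLex.injective h2
      exact hne (by rw [h3, h4])
    · exact fun h => (h (by rw [Finset.HasAntidiagonal.mem_antidiagonal])).elim
  · rw [MvPolynomial.coeff_mul] at hd'
    obtain ⟨⟨a, b⟩, hab, h⟩ := Finset.exists_ne_zero_of_sum_ne_zero hd'
    have hab' : toLex a + toLex b = toLex d' := by
      rw [← toLex_add, Finset.HasAntidiagonal.mem_antidiagonal.1 hab]
    rw [← hab']
    exact add_le_add (hp.2 a (left_ne_zero_of_mul h)) (hq.2 b (right_ne_zero_of_mul h))

variable {M : Type*} [AddCommGroup M] [Module k M] (T : M →ₗ[k] MvPolynomial σ k)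
  {X : Set (σ →₀ ℕ)} {g : X → M}

/-- In a vanishing combination, the largest leading exponent with nonzero coefficient occurs in one
term only. -/
theorem linearIndependent_of_isLead (hg : ∀ d, IsLead (T (g d)) d.1) :
    LinearIndependent k g := by
  classical
  rw [linearIndependent_iff']
  intro s c hs
  by_contra! hne
  obtain ⟨i0, hi0, hci0⟩ := hne
  obtain ⟨i, hi, hmax⟩ := Finset.exists_max_image (s.filter fun i => c i ≠ 0)
    (fun i => toLex i.1) ⟨i0, by simp [hi0, hci0]⟩
  rw [Finset.mem_filter] at hi
  have h1 := congrArg (fun x => MvPolynomial.coeff i.1 (T x)) hs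
  simp only [map_sum, map_smul, map_zero, MvPolynomial.coeff_sum, MvPolynomial.coeff_smul,
    MvPolynomial.coeff_zero] at h1
  rw [Finset.sum_eq_single i] at h1
  · rw [(hg i).1] at h1
    exact hi.2 (by simpa using h1)
  · intro j hj hji
    by_cases hcj : c j = 0
    · rw [hcj, zero_smul]
    · by_contra hc
      have h2 := (hg j).2 i.1 (right_ne_zero_of_mul hc)
      have h3 := hmax j (Finset.mem_filter.2 ⟨hj, hcj⟩)
      exact hji (Subtype.ext (toLex.injective (le_antisymm h3 h2)))
  · intro h; exact absurd hi.1 h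

/-- Division algorithm: subtracting the right multiple of `g d` lowers the leading exponent, and the
lexicographic order in finitely many variables is well founded. Leading coefficient 1 makes this
work without division. -/
theorem span_eq_top_of_isLead [Finite σ] (hT : Function.Injective T) (hg : ∀ d, IsLead (T (g d)) d.1)
    (hX : ∀ x d, IsTopExp (T x) d → d ∈ X) :
    ⊤ ≤ Submodule.span k (Set.range g) := by
  have key : ∀ (t : Lex (σ →₀ ℕ)) (x : M) (d : σ →₀ ℕ), toLex d = t → IsTopExp (T x) d →
      x ∈ Submodule.span k (Set.range g) := by
    intro t
    induction t using WellFoundedLT.induction with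
    | _ t ih =>
      rintro x d rfl hd
      let y := MvPolynomial.coeff d (T x) • g ⟨d, hX x d hd⟩
      have hy : y ∈ Submodule.span k (Set.range g) :=
        Submodule.smul_mem _ _ (Submodule.subset_span ⟨_, rfl⟩)
      suffices hxy : x - y ∈ Submodule.span k (Set.range g) by
        simpa using add_mem hxy hy
      by_cases h0 : T (x - y) = 0
      · rw [hT (h0.trans (map_zero T).symm)]
        exact zero_mem _
      · obtain ⟨d', hd'⟩ := exists_isTopExp h0
        refine ih _ (lt_of_le_of_ne ?_ ?_) _ d' rfl hd'
        · have h1 := hd'.1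
          rw [map_sub, map_smul, MvPolynomial.coeff_sub, MvPolynomial.coeff_smul] at h1
          by_cases h2 : MvPolynomial.coeff d' (T x) = 0
          · rw [h2, zero_sub, neg_ne_zero] at h1
            exact (hg _).2 d' (right_ne_zero_of_mul h1)
          · exact hd.2 d' h2
        · intro h
          have h1 := hd'.1
          have h2 : MvPolynomial.coeff d (T (g ⟨d, hX x d hd⟩)) = 1 := (hg _).1
          rw [toLex.injective h, map_sub, map_smul, MvPolynomial.coeff_sub,
            MvPolynomial.coeff_smul, h2] at h1
          simp at h1
  intro x _
  by_cases hx : T x = 0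
  · rw [hT (hx.trans (map_zero T).symm)]
    exact zero_mem _
  · obtain ⟨d, hd⟩ := exists_isTopExp hx
    exact key _ x d rfl hd

end LeadingTerms

/-! ### Which leading exponents occur. -/

section Exponents

theorem lex_lt_mapDomain_swap {N : ℕ} {d : Fin N →₀ ℕ} {i j : Fin N} (hij : i < j)
    (hd : d i < d j) : toLex d < toLex (Finsupp.mapDomain (Equiv.swap i j) d) := by
  refine ⟨i, fun k hk => ?_, ?_⟩
  all_goals dsimp only [ofLex_toLex]
  · conv_rhs => rw [← Equiv.swap_apply_of_ne_of_ne hk.ne (hk.trans hij).ne]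
    rw [Finsupp.mapDomain_apply (Equiv.injective _)]
  · refine hd.trans_eq ?_
    simp_rw [Finsupp.mapDomain_equiv_apply, Equiv.symm_swap, Equiv.swap_apply_left]

/-- The possible leading exponents of the coefficients of `θ_{n+1} ⋯ θ_{n+m}` in symmetric
superpolynomials of degree `(n|m)` in `n + m` variables. -/
def topExps (n m : ℕ) : Set (Fin (n + m) →₀ ℕ) :=
  {d | Antitone (d ∘ Fin.castAdd m) ∧ StrictAnti (d ∘ Fin.natAdd n) ∧ ∑ i, d i = n}

variable {R : Type*} [CommRing R]

theorem mem_topExps [NoZeroDivisors R] [CharZero R] {n m : ℕ} {f : ∀ N, SuperPoly R N} (hf : f ∈ familyDeg R n m)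
    {d : Fin (n + m) →₀ ℕ}
    (hd : IsTopExp (thetaCoeff R (Fin.natAdd n : Fin m → Fin (n + m)) (f (n + m))) d) :
    d ∈ topExps n m := by
  set j : Fin m → Fin (n + m) := Fin.natAdd n with hj
  refine ⟨fun a b hab => ?_, fun a b hab => ?_, ?_⟩
  · by_contra! hlt
    have hab' : a < b := lt_of_le_of_ne hab (by rintro rfl; exact lt_irrefl _ hlt)
    let σ := Equiv.swap (Fin.castAdd m a) (Fin.castAdd m b)
    have hσ : σ ∘ j = j := by
      funext r
      refine Equiv.swap_apply_of_ne_of_ne ?_ ?_ <;>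
      · intro h
        have := congrArg Fin.val h
        simp [hj] at this
        omega
    have h1 : MvPolynomial.coeff (Finsupp.mapDomain σ d) (thetaCoeff R j (f (n + m))) ≠ 0 := by
      rw [← hσ, ← rename_thetaCoeff hf, MvPolynomial.coeff_rename_mapDomain _ σ.injective]
      exact hd.1
    exact absurd (hd.2 _ h1) (not_le.2 (lex_lt_mapDomain_swap (Fin.lt_def.2 hab') hlt))
  · let σ := Equiv.swap (Fin.natAdd n a) (Fin.natAdd n b)
    have hσ : σ ∘ j = j ∘ Equiv.swap a b := by
      funext r
      exact (Equiv.swap_apply_def _ _ _).trans (by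
        rw [Function.comp_apply, Equiv.swap_apply_def]
        simp only [hj, Fin.natAdd_inj]
        split_ifs <;> rfl)
    have h0 : MvPolynomial.coeff (Finsupp.mapDomain σ d) (thetaCoeff R j (f (n + m))) =
        -MvPolynomial.coeff d (thetaCoeff R j (f (n + m))) := by
      rw [← MvPolynomial.coeff_rename_mapDomain σ σ.injective _ d, rename_thetaCoeff hf, hσ,
        thetaCoeff_comp_perm, Equiv.Perm.sign_swap hab.ne]
      simp
    -- A swap among the last `m` indices negates the coefficient, so an increase contradicts
    -- maximality, and equal entries make the coefficient its own negative, hence 0 in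
    -- characteristic zero.
    have h1 := hd.2 _ (by rw [h0]; exact neg_ne_zero.2 hd.1)
    rcases lt_trichotomy (d (j a)) (d (j b)) with h | h | h
    · exact absurd h1 (not_le.2 (lex_lt_mapDomain_swap (by simpa [hj] using hab) h))
    · have h2 : Finsupp.mapDomain σ d = d := by
        ext i
        rw [Finsupp.mapDomain_equiv_apply, Equiv.symm_swap, Equiv.swap_apply_def]
        split_ifs with h3 h4
        · rw [h3]; exact h.symm
        · rw [h4]; exact h
        · rfl
      rw [h2] at h0
      exact absurd (self_eq_neg.1 h0) hd.1
    · exact h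
  · have := thetaCoeff_isHomogeneous R (hf.2.2 (n + m)) j hd.1
    rw [Finsupp.weight_apply, Finsupp.sum_fintype _ _ (by simp)] at this
    simpa using this

variable (R) in
-- In the Leibniz expansion the identity permutation wins: the first index moved by any other
-- permutation is sent to a larger one, where the strictly decreasing `k` is smaller.
theorem isLead_det {n m : ℕ} {k : Fin m → ℕ} (hk : StrictAnti k) :
    IsLead (Matrix.of fun l r : Fin m =>
      (MvPolynomial.X (Fin.natAdd n r) : MvPolynomial (Fin (n + m)) R) ^ k l).det
      (Finsupp.equivFunOnFinite.symm (Fin.append (fun _ => 0) k)) := by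
  classical
  let κ : Equiv.Perm (Fin m) → Fin (n + m) →₀ ℕ := fun τ =>
    Finsupp.equivFunOnFinite.symm (Fin.append (fun _ => 0) (k ∘ τ))
  have hdet : (Matrix.of fun l r : Fin m =>
      (MvPolynomial.X (Fin.natAdd n r) : MvPolynomial (Fin (n + m)) R) ^ k l).det =
      ∑ τ : Equiv.Perm (Fin m), MvPolynomial.monomial (κ τ) ((Equiv.Perm.sign τ : ℤ) : R) := by
    rw [Matrix.det_apply]
    refine Finset.sum_congr rfl fun τ _ => ?_
    rw [MvPolynomial.monomial_eq, Finsupp.prod_fintype _ _ (fun i => pow_zero _),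
      Fin.prod_univ_add, Units.smul_def, zsmul_eq_mul]
    simp [κ]
  have hlt : ∀ τ : Equiv.Perm (Fin m), τ ≠ 1 → toLex (κ τ) < toLex (κ 1) := by
    intro τ hτ
    obtain ⟨i0, hi0⟩ : ∃ i, τ i ≠ i := by
      by_contra! h
      exact hτ (Equiv.ext h)
    let i := (Finset.univ.filter fun i => τ i ≠ i).min' ⟨i0, by simpa using hi0⟩
    have hi : τ i ≠ i := by
      have := Finset.min'_mem (Finset.univ.filter fun i => τ i ≠ i) ⟨i0, by simpa using hi0⟩
      simpa using this
    have hmin : ∀ r < i, τ r = r := by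
      intro r hr
      by_contra h
      exact absurd (Finset.min'_le (Finset.univ.filter fun i => τ i ≠ i) r (by simpa using h))
        (not_le.2 hr)
    refine ⟨Fin.natAdd n i, fun s hs => ?_, ?_⟩
    · refine Fin.addCases (fun s _ => ?_) (fun s hs => ?_) s hs
      · simp [κ]
      · have hs' : s < i := by simpa using hs
        simp [κ, hmin s hs']
    · have hgt : i < τ i := by
        refine lt_of_le_of_ne (not_lt.1 fun h => ?_) hi.symm
        exact hi (τ.injective (hmin _ h))
      simpa [κ] using hk hgt
  rw [hdet]
  refine ⟨?_, fun d' hd' => ?_⟩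
  · rw [MvPolynomial.coeff_sum, Finset.sum_eq_single 1]
    · rw [MvPolynomial.coeff_monomial, if_pos (show κ 1 = Finsupp.equivFunOnFinite.symm (Fin.append (fun _ => 0) k) from rfl)]
      simp
    · intro τ _ hτ
      rw [MvPolynomial.coeff_monomial, if_neg]
      intro h
      exact (hlt τ hτ).ne (congrArg toLex h)
    · simp
  · rw [MvPolynomial.coeff_sum] at hd'
    obtain ⟨τ, -, hτ⟩ := Finset.exists_ne_zero_of_sum_ne_zero hd'
    rw [MvPolynomial.coeff_monomial] at hτ
    have h1 : κ τ = d' := by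
      by_contra h
      rw [if_neg h] at hτ
      exact hτ rfl
    rw [← h1]
    by_cases h2 : τ = 1
    · rw [h2]; exact le_rfl
    · exact (hlt τ h2).le

variable (R) in
-- This is the leading term from the fundamental theorem of symmetric polynomials.
theorem isLead_esymmAlgHomMonomial [Nontrivial R] {N : ℕ} (t : Fin N →₀ ℕ) :
    IsLead (MvPolynomial.esymmAlgHomMonomial (Fin N) t (1 : R))
      (Finsupp.equivFunOnFinite.symm (Fin.accumulate N N t)) := by
  have h1 := MvPolynomial.supDegree_esymmAlgHomMonomial (R := R) one_ne_zero t le_rfl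
  have h2 := MvPolynomial.leadingCoeff_esymmAlgHomMonomial (r := (1 : R)) t le_rfl
  rw [MvPolynomial.leadingCoeff_toLex] at h2
  have h3 : ofLex (AddMonoidAlgebra.supDegree toLex
      (MvPolynomial.esymmAlgHomMonomial (Fin N) t (1 : R))) =
      Finsupp.equivFunOnFinite.symm (Fin.accumulate N N t) := DFunLike.ext' h1
  rw [h3] at h2
  refine ⟨h2, fun d' hd' => ?_⟩
  rw [← h3, toLex_ofLex]
  by_contra hlt
  exact hd' (AddMonoidAlgebra.coeff_eq_zero_of_not_le_supDegree hlt)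

end Exponents

/-! ### The bigrading and its projections. -/

section Degrees

variable (R : Type*) [CommRing R]

theorem ofMono_mem (n m : ℕ) (C : ∀ N, (Fin m → Fin N) → (Fin N → ℕ) → Prop) (hperm) (hres) :
    ofMono R n m C hperm hres ∈ SymDeg R n m :=
  monoSum_mem R n m C hperm hres

theorem e_mem (n : ℕ) : e R n ∈ SymDeg R n 0 := ofMono_mem R _ _ _ _ _

theorem et_mem (n : ℕ) : et R n ∈ SymDeg R n 1 := ofMono_mem R _ _ _ _ _

theorem msym_mem {n m : ℕ} (L : SParDeg n m) : msym R L.1 ∈ SymDeg R n m := by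
  obtain ⟨L, rfl, rfl⟩ := L
  exact ofMono_mem R _ _ _ _ _

theorem h_mem (n : ℕ) : h R n ∈ SymDeg R n 0 := Submodule.sum_mem _ fun L _ => msym_mem R L

theorem ht_mem (n : ℕ) : ht R n ∈ SymDeg R n 1 :=
  Submodule.sum_mem _ fun L _ => Submodule.smul_of_tower_mem _ _ (msym_mem R L)

theorem one_mem_SymDeg : (1 : SymRing R) ∈ SymDeg R 0 0 := one_mem_familyDeg R

variable {R}

theorem mul_mem_SymDeg {n m n' m' : ℕ} {f g : SymRing R} (hf : f ∈ SymDeg R n m)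
    (hg : g ∈ SymDeg R n' m') : f * g ∈ SymDeg R (n + n') (m + m') :=
  familyDeg_mul R hf hg

theorem pow_mem_SymDeg {n m : ℕ} {f : SymRing R} (hf : f ∈ SymDeg R n m) (k : ℕ) :
    f ^ k ∈ SymDeg R (k * n) (k * m) := by
  induction k with
  | zero => simpa using one_mem_SymDeg R
  | succ k ih =>
    rw [pow_succ, Nat.succ_mul, Nat.succ_mul]
    exact mul_mem_SymDeg ih hf

theorem map_prod_mem_SymDeg {a : ℕ → SymRing R} {c : ℕ} (ha : ∀ k, a k ∈ SymDeg R k c)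
    (l : List ℕ) : (l.map a).prod ∈ SymDeg R l.sum (l.length * c) := by
  induction l with
  | nil => simpa using one_mem_SymDeg R
  | cons k l ih =>
    rw [List.map_cons, List.prod_cons, List.sum_cons, List.length_cons, Nat.succ_mul,
      add_comm (l.length * c)]
    exact mul_mem_SymDeg (ha k) ih

theorem ofFn_prod_mem_SymDeg {k : ℕ} {a : Fin k → SymRing R} {c d : Fin k → ℕ}
    (ha : ∀ i, a i ∈ SymDeg R (c i) (d i)) :
    (List.ofFn a).prod ∈ SymDeg R (∑ i, c i) (∑ i, d i) := by
  induction k with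
  | zero => simpa using one_mem_SymDeg R
  | succ k ih =>
    rw [List.ofFn_succ, List.prod_cons, Fin.sum_univ_succ, Fin.sum_univ_succ]
    exact mul_mem_SymDeg (ha 0) (ih fun i => ha i.succ)

theorem superProd_mem {a b : ℕ → SymRing R} (ha : ∀ k, a k ∈ SymDeg R k 0)
    (hb : ∀ k, b k ∈ SymDeg R k 1) {n m : ℕ} (L : SParDeg n m) :
    superProd a b L.1 ∈ SymDeg R n m := by
  obtain ⟨L, rfl, rfl⟩ := L
  have := mul_mem_SymDeg (map_prod_mem_SymDeg hb L.anti) (map_prod_mem_SymDeg ha L.symm)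
  rwa [mul_one, mul_zero, add_zero] at this

theorem neg_one_pow_mul_mem {n m : ℕ} {f : SymRing R} (k : ℕ) (hf : f ∈ SymDeg R n m) :
    (-1) ^ k * f ∈ SymDeg R n m := by
  have : (-1) ^ k * f = ((-1 : R) ^ k) • f := by
    rw [Algebra.smul_def, map_pow, map_neg, map_one]
  rw [this]
  exact Submodule.smul_mem _ _ hf

theorem pt_mem (n : ℕ) : pt R n ∈ SymDeg R n 1 := by
  refine Submodule.sum_mem _ fun q hq => neg_one_pow_mul_mem _ ?_
  have := mul_mem_SymDeg (et_mem R q.1) (h_mem R q.2)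
  rwa [Finset.HasAntidiagonal.mem_antidiagonal.1 hq] at this

variable (R)

/-- The projection onto the component of degree `(n|m)`. -/
def superProj (N n m : ℕ) : SuperPoly R N →ₗ[R] SuperPoly R N :=
  TensorProduct.map (MvPolynomial.homogeneousComponent n)
    (GradedAlgebra.proj (fun i : ℕ => ⋀[R]^i (Fin N → R)) m)

variable {R}

theorem superProj_of_mem {N n m : ℕ} {f : SuperPoly R N} (hf : f ∈ homog R N n m) :
    superProj R N n m f = f := by
  unfold homog at hf
  induction hf using Submodule.span_induction with
  | mem f hf =>
    obtain ⟨p, hp, w, hw, rfl⟩ := hf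
    rw [superProj, TensorProduct.map_tmul, MvPolynomial.homogeneousComponent_of_mem hp, if_pos rfl,
      GradedAlgebra.proj_apply, DirectSum.decompose_of_mem_same (fun i : ℕ => ⋀[R]^i (Fin N → R)) hw]
  | zero => exact map_zero _
  | add f g _ _ hf hg => rw [map_add, hf, hg]
  | smul c f _ hf => rw [map_smul, hf]

theorem superProj_of_mem_of_ne {N n m n' m' : ℕ} {f : SuperPoly R N} (hf : f ∈ homog R N n' m')
    (hne : (n', m') ≠ (n, m)) : superProj R N n m f = 0 := by
  unfold homog at hf
  induction hf using Submodule.span_induction with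
  | mem f hf =>
    obtain ⟨p, hp, w, hw, rfl⟩ := hf
    rw [superProj, TensorProduct.map_tmul, MvPolynomial.homogeneousComponent_of_mem hp]
    by_cases hn : n = n'
    · rw [GradedAlgebra.proj_apply, DirectSum.decompose_of_mem_ne (fun i : ℕ => ⋀[R]^i (Fin N → R)) hw, TensorProduct.tmul_zero]
      rintro rfl
      exact hne (by rw [hn])
    · rw [if_neg hn, TensorProduct.zero_tmul]
  | zero => exact map_zero _
  | add f g _ _ hf hg => rw [map_add, hf, hg, add_zero]
  | smul c f _ hf => rw [map_smul, hf, smul_zero]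

variable (R)

/-- The componentwise projection of a family onto degree `(n|m)`. -/
def familyProj (n m : ℕ) : (∀ N, SuperPoly R N) →ₗ[R] ∀ N, SuperPoly R N :=
  LinearMap.pi fun N => (superProj R N n m).comp (LinearMap.proj N)

variable {R}

theorem familyProj_of_mem {n m : ℕ} {f : ∀ N, SuperPoly R N} (hf : f ∈ familyDeg R n m) :
    familyProj R n m f = f :=
  funext fun N => superProj_of_mem (hf.2.2 N)

theorem familyProj_of_mem_of_ne {n m n' m' : ℕ} {f : ∀ N, SuperPoly R N}
    (hf : f ∈ familyDeg R n' m') (hne : (n', m') ≠ (n, m)) : familyProj R n m f = 0 :=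
  funext fun N => superProj_of_mem_of_ne (hf.2.2 N) hne

theorem familyProj_mem {n m : ℕ} (f : SymRing R) : familyProj R n m f.1 ∈ familyDeg R n m := by
  have h1 : (⨆ d : ℕ × ℕ, familyDeg R d.1 d.2) ≤
      (familyDeg R n m).comap (familyProj R n m) := by
    refine iSup_le fun d f hf => ?_
    rw [Submodule.mem_comap]
    by_cases hd : (d.1, d.2) = (n, m)
    · obtain ⟨d1, d2⟩ := d
      obtain ⟨rfl, rfl⟩ := Prod.mk.inj hd
      rwa [familyProj_of_mem hf]
    · rw [familyProj_of_mem_of_ne hf hd]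
      exact zero_mem _
  exact h1 f.2

variable (R)

/-- The projection of a symmetric superfunction onto its component of degree `(n|m)`. -/
def degProj (n m : ℕ) : SymRing R →ₗ[R] SymDeg R n m :=
  LinearMap.codRestrict _ (LinearMap.codRestrict (Subalgebra.toSubmodule (SymRing R))
    ((familyProj R n m).comp (SymRing R).val.toLinearMap)
    fun f => mem_SymRing_of_mem R (familyProj_mem f)) fun f => familyProj_mem f

variable {R}

theorem degProj_of_mem {n m : ℕ} {f : SymRing R} (hf : f ∈ SymDeg R n m) :
    degProj R n m f = ⟨f, hf⟩ :=
  Subtype.ext (Subtype.ext (familyProj_of_mem hf))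

theorem degProj_of_mem_of_ne {n m n' m' : ℕ} {f : SymRing R} (hf : f ∈ SymDeg R n' m')
    (hne : (n', m') ≠ (n, m)) : degProj R n m f = 0 :=
  Subtype.ext (Subtype.ext (familyProj_of_mem_of_ne hf hne))

theorem iSup_SymDeg : (⨆ d : ℕ × ℕ, SymDeg R d.1 d.2) = ⊤ := by
  refine eq_top_iff.2 fun f _ => ?_
  have h1 : (⨆ d : ℕ × ℕ, familyDeg R d.1 d.2) ≤
      (⨆ d : ℕ × ℕ, SymDeg R d.1 d.2).map (SymRing R).val.toLinearMap := by
    refine iSup_le fun d g hg => ?_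
    exact ⟨⟨g, mem_SymRing_of_mem R hg⟩,
      Submodule.mem_iSup_of_mem (p := fun d : ℕ × ℕ => SymDeg R d.1 d.2) d hg, rfl⟩
  obtain ⟨g, hg, hgf⟩ := h1 f.2
  rwa [← Subtype.ext hgf]

end Degrees

/-! ### A basis of each degree with prescribed leading terms. -/

section DegreeBasis

variable (R : Type*) [CommRing R]

/-- The additive group of symmetric superfunctions. -/
abbrev symRingAddCommGroup : AddCommGroup (SymRing R) := Ring.toAddCommGroup

attribute [local instance] symRingAddCommGroup

/-- The additive group of symmetric superfunctions of degree `(n|m)`. -/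
abbrev symDegAddCommGroup (n m : ℕ) : AddCommGroup (SymDeg R n m) := Submodule.addCommGroup _

attribute [local instance] symDegAddCommGroup

theorem coeff_weightE_eq_esymm {N : ℕ} (n : ℕ) : PowerSeries.coeff n
    (weightSeries (MvPolynomial.X : Fin N → MvPolynomial (Fin N) R) fun _ => weightE) =
      MvPolynomial.esymm (Fin N) R n := by
  classical
  rw [weightSeries]
  simp only [mk_weightE]
  rw [Finset.prod_one_add, map_sum, MvPolynomial.esymm, Finset.powersetCard_eq_filter,
    Finset.sum_filter]
  refine Finset.sum_congr rfl fun t _ => ?_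
  rw [Finset.prod_mul_distrib, Finset.prod_const, ← map_prod, PowerSeries.coeff_C_mul,
    PowerSeries.coeff_X_pow]
  simp [eq_comm]

/-- The part in `N` variables, as a ring homomorphism. -/
def evalHom (N : ℕ) : SymRing R →ₐ[R] SuperPoly R N :=
  (Pi.evalAlgHom R (SuperPoly R) N).comp (SymRing R).val

theorem evalHom_apply (N : ℕ) (f : SymRing R) : evalHom R N f = f.1 N := rfl

/-- The coefficient of `θ_{n+1} ⋯ θ_{n+m}` in `n + m` variables. -/
def topCoeff (n m : ℕ) : SymDeg R n m →ₗ[R] MvPolynomial (Fin (n + m)) R :=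
  (thetaCoeff R (Fin.natAdd n : Fin m → Fin (n + m))).comp
    ((evalHom R (n + m)).toLinearMap.comp (SymDeg R n m).subtype)

theorem topCoeff_apply {n m : ℕ} (f : SymDeg R n m) : topCoeff R n m f =
    thetaCoeff R (Fin.natAdd n : Fin m → Fin (n + m)) (f.1.1 (n + m)) := rfl

theorem topCoeff_injective (n m : ℕ) : Function.Injective (topCoeff R n m) := by
  rw [← LinearMap.ker_eq_bot, LinearMap.ker_eq_bot']
  intro f hf
  have h1 := apply_eq_zero_of_thetaCoeff f.2 (Fin.natAdd_injective m n) hf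
  have h2 : f.1.1 = 0 := eq_zero_of_apply_eq_zero f.2 le_rfl h1
  exact Subtype.ext (Subtype.ext h2)

/-- The exponents of the elementary symmetric functions whose product has leading exponent
given by the first `n` entries of `d`. -/
def esymmExps {n m : ℕ} (d : Fin (n + m) →₀ ℕ) : Fin (n + m) →₀ ℕ :=
  Finsupp.equivFunOnFinite.symm (Fin.invAccumulate (n + m) (n + m)
    (Fin.append (d ∘ Fin.castAdd m) fun _ => 0))

/-- Padding by zeros at the end keeps the vector weakly decreasing, which is what inverting
`Fin.accumulate` requires. -/
theorem accumulate_esymmExps {n m : ℕ} {d : Fin (n + m) →₀ ℕ} (hd : d ∈ topExps n m) :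
    Fin.accumulate (n + m) (n + m) (esymmExps d) = Fin.append (d ∘ Fin.castAdd m) fun _ => 0 := by
  refine Fin.accumulate_invAccumulate le_rfl fun a b hab => ?_
  induction b using Fin.addCases with
  | right b => simp
  | left b =>
    induction a using Fin.addCases with
    | left a => simpa using hd.1 (Fin.le_def.2 (Fin.le_def.1 hab))
    | right a =>
      have := Fin.le_def.1 hab
      simp at this
      omega

/-- A symmetric superfunction of degree `(n|m)` with leading exponent `d`. -/
def leadElem {n m : ℕ} (d : Fin (n + m) →₀ ℕ) : SymRing R :=
  (List.ofFn fun r : Fin m => pt R (d (Fin.natAdd n r))).prod *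
    (List.ofFn fun i : Fin (n + m) => e R (i + 1) ^ esymmExps d i).prod

/-- The right side is the degree of the product of the `e (i + 1) ^ t i`, the left side that of its
leading monomial. -/
theorem sum_accumulate {N : ℕ} (t : Fin N → ℕ) :
    ∑ i, Fin.accumulate N N t i = ∑ i : Fin N, t i * (i + 1) := by
  simp only [Fin.accumulate_apply, Finset.sum_filter]
  rw [Finset.sum_comm]
  refine Finset.sum_congr rfl fun i _ => ?_
  rw [← Finset.sum_filter, Finset.sum_const, smul_eq_mul, mul_comm]
  congr 1
  exact (congrArg Finset.card (Finset.ext fun j => by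
    simp only [Finset.mem_filter, Finset.mem_univ, true_and, Finset.mem_Iic, Fin.le_def])).trans (Fin.card_Iic i)

theorem leadElem_mem {n m : ℕ} {d : Fin (n + m) →₀ ℕ} (hd : d ∈ topExps n m) :
    leadElem R d ∈ SymDeg R n m := by
  have h1 := mul_mem_SymDeg
    (ofFn_prod_mem_SymDeg fun r : Fin m => pt_mem (R := R) (d (Fin.natAdd n r)))
    (ofFn_prod_mem_SymDeg fun i : Fin (n + m) =>
      pow_mem_SymDeg (e_mem R (i + 1)) (esymmExps d i))
  have h2 := sum_accumulate (esymmExps d)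
  have h3 := hd.2.2
  rw [accumulate_esymmExps hd, Fin.sum_univ_add] at h2
  rw [Fin.sum_univ_add] at h3
  simp only [Fin.append_left, Fin.append_right, Function.comp_apply, Finset.sum_const_zero,
    add_zero] at h2
  rw [← h2, add_comm (∑ i : Fin m, d (Fin.natAdd n i)), h3] at h1
  simpa [leadElem] using h1

variable [IsDomain R]

theorem isLead_leadElem {n m : ℕ} {d : Fin (n + m) →₀ ℕ} (hd : d ∈ topExps n m) :
    IsLead (topCoeff R n m ⟨leadElem R d, leadElem_mem R hd⟩) d := by
  have hval : (leadElem R d).1 (n + m) =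
      (List.ofFn fun r : Fin m => oddPart R fun i => MvPolynomial.X i ^ d (Fin.natAdd n r)).prod *
        evalHom R (n + m) (List.ofFn fun i : Fin (n + m) => e R (i + 1) ^ esymmExps d i).prod := by
    rw [leadElem, ← evalHom_apply, map_mul, map_list_prod, List.map_ofFn]
    congr 3
    funext r
    exact pt_val R _ _
  have hval2 : evalHom R (n + m) (List.ofFn fun i : Fin (n + m) => e R (i + 1) ^ esymmExps d i).prod =
      evenPart R (MvPolynomial.esymmAlgHomMonomial (Fin (n + m)) (esymmExps d) 1) := by
    rw [MvPolynomial.esymmAlgHomMonomial, MvPolynomial.esymmAlgHom_apply,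
      MvPolynomial.aeval_monomial, map_one, one_mul, Finsupp.prod_fintype _ _ fun i => pow_zero _,
      ← List.prod_ofFn, map_list_prod, map_list_prod, List.map_ofFn, List.map_ofFn]
    congr 2
    funext i
    simp only [Function.comp_apply, map_pow]
    rw [evalHom_apply, e_val, coeff_weightE_eq_esymm]
  rw [topCoeff_apply, hval, hval2, thetaCoeff_prod_oddPart]
  have h1 := (isLead_det R (n := n) hd.2.1).mul (isLead_esymmAlgHomMonomial R (esymmExps d))
  -- The determinant accounts for the last `m` entries of `d`, the elementary symmetric functions
  -- for the first `n`.
  have h2 : d = Finsupp.equivFunOnFinite.symm (Fin.append (fun _ => 0) (d ∘ Fin.natAdd n)) +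
      Finsupp.equivFunOnFinite.symm (Fin.accumulate (n + m) (n + m) (esymmExps d)) := by
    rw [accumulate_esymmExps hd]
    ext i
    induction i using Fin.addCases <;> simp
  conv_rhs => rw [h2]
  exact h1

variable [CharZero R]

/-- The basis of the symmetric superfunctions of degree `(n|m)` with prescribed leading terms. -/
def leadBasis (n m : ℕ) : Module.Basis (topExps n m) R (SymDeg R n m) :=
  Module.Basis.mk (v := fun d => ⟨leadElem R d.1, leadElem_mem R d.2⟩)
    (linearIndependent_of_isLead (topCoeff R n m) fun d => isLead_leadElem R d.2)
    (span_eq_top_of_isLead (topCoeff R n m) (topCoeff_injective R n m)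
      (fun d => isLead_leadElem R d.2) fun f _ hd => mem_topExps f.2 hd)

theorem leadBasis_apply {n m : ℕ} (d : topExps n m) :
    (leadBasis R n m d : SymRing R) = leadElem R d.1 := by
  rw [leadBasis, Module.Basis.mk_apply]

end DegreeBasis

/-! ### Cancelling series and transporting relations. -/

section DualPairs

variable {S : Type*} [Ring S]

/-- A power series with constant term 1 can be cancelled, one coefficient at a time. -/
theorem eq_of_sum_antidiagonal_eq {c u v : ℕ → S} (hc : c 0 = 1)
    (huv : ∀ n, ∑ q ∈ Finset.HasAntidiagonal.antidiagonal n, (-1) ^ q.1 * (c q.1 * u q.2) =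
      ∑ q ∈ Finset.HasAntidiagonal.antidiagonal n, (-1) ^ q.1 * (c q.1 * v q.2)) (n : ℕ) :
    u n = v n := by
  induction n using Nat.strong_induction_on with
  | _ n ih =>
    rcases n with _ | n
    · simpa [hc] using huv 0
    · have h1 := huv (n + 1)
      rw [Finset.Nat.sum_antidiagonal_succ, Finset.Nat.sum_antidiagonal_succ] at h1
      have h2 : ∀ q ∈ Finset.HasAntidiagonal.antidiagonal n, u q.2 = v q.2 := fun q hq =>
        ih _ (Nat.lt_succ_of_le (by
          have := Finset.HasAntidiagonal.mem_antidiagonal.1 hq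
          omega))
      rw [Finset.sum_congr rfl fun q hq => by rw [h2 q hq]] at h1
      simpa [hc] using h1

/-- This is the substitution t ↦ -t, read on the coefficient of `t^n`. -/
theorem sum_antidiagonal_neg_one_pow_swap (f : ℕ → ℕ → S) (n : ℕ) :
    ∑ q ∈ Finset.HasAntidiagonal.antidiagonal n, (-1) ^ q.1 * f q.2 q.1 =
      (-1) ^ n * ∑ q ∈ Finset.HasAntidiagonal.antidiagonal n, (-1) ^ q.1 * f q.1 q.2 := by
  rw [← Finset.Nat.sum_antidiagonal_swap, Finset.mul_sum]
  refine Finset.sum_congr rfl fun q hq => ?_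
  rw [← mul_assoc, ← pow_add, ← Finset.HasAntidiagonal.mem_antidiagonal.1 hq,
    add_right_comm, pow_add _ (q.1 + q.1), Even.neg_one_pow ⟨q.1, rfl⟩, one_mul]
  rfl

theorem sum_antidiagonal_mem {u v : ℕ → S} {k : Type*} [CommRing k] [Algebra k S]
    (V : Subalgebra k S) (hu : ∀ n, u n ∈ V) (hv : ∀ n, v n ∈ V) (n : ℕ) :
    ∑ q ∈ Finset.HasAntidiagonal.antidiagonal n, (-1) ^ q.1 * (u q.1 * v q.2) ∈ V :=
  sum_mem fun _ _ => mul_mem (pow_mem (neg_mem (one_mem V)) _) (mul_mem (hu _) (hv _))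

theorem mem_of_sum_antidiagonal {c u : ℕ → S} {k : Type*} [CommRing k] [Algebra k S]
    (V : Subalgebra k S) (hc : c 0 = 1)
    (hcu : ∀ n, ∑ q ∈ Finset.HasAntidiagonal.antidiagonal n, (-1) ^ q.1 * (c q.1 * u q.2) =
      if n = 0 then 1 else 0) (hV : ∀ n, c n ∈ V) (n : ℕ) : u n ∈ V := by
  induction n using Nat.strong_induction_on with
  | _ n ih =>
    rcases n with _ | n
    · have h1 : u 0 = 1 := by simpa [hc] using hcu 0
      rw [h1]
      exact one_mem V
    · have h1 := hcu (n + 1)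
      rw [Finset.Nat.sum_antidiagonal_succ, if_neg n.succ_ne_zero] at h1
      simp only [pow_zero, hc, one_mul] at h1
      rw [eq_neg_of_add_eq_zero_left h1]
      refine neg_mem (sum_mem fun q hq => mul_mem (pow_mem (neg_mem (one_mem V)) _)
        (mul_mem (hV _) (ih _ (Nat.lt_succ_of_le ?_))))
      have := Finset.HasAntidiagonal.mem_antidiagonal.1 hq
      omega

/-- Applying `f` to A(-t) A'(t) = 1 gives A'(-t) f(A')(t) = 1, while t ↦ -t gives A'(-t) A(t) = 1;
cancel A'(-t). -/
theorem map_dual_even {a a' : ℕ → S} (ha' : a' 0 = 1) (hcomm : ∀ n x, Commute (a n) x)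
    (hrel : ∀ n, ∑ q ∈ Finset.HasAntidiagonal.antidiagonal n, (-1) ^ q.1 * (a q.1 * a' q.2) =
      if n = 0 then 1 else 0) (f : S →+* S) (hf : ∀ n, f (a n) = a' n) (n : ℕ) :
    f (a' n) = a n := by
  refine eq_of_sum_antidiagonal_eq (c := a') (u := fun n => f (a' n)) ha' (fun n => ?_) n
  have h1 := congrArg f (hrel n)
  simp only [map_sum, map_mul, map_pow, map_neg, map_one, hf] at h1
  rw [h1]
  have h2 := sum_antidiagonal_neg_one_pow_swap (fun i j => a i * a' j) n
  rw [hrel] at h2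
  simp only [(hcomm _ _).eq] at h2
  rw [h2]
  by_cases hn : n = 0
  · simp [hn]
  · simp [hn]

/-- Applying `f` to A(-t) B'(t) = B(-t) A'(t) gives A'(-t) f(B')(t) = B'(-t) A(t). By t ↦ -t in the
original relation the right side is A'(-t) B(t); cancel A'(-t). -/
theorem map_dual_odd {a b a' b' : ℕ → S} (ha' : a' 0 = 1) (hcomm : ∀ n x, Commute (a n) x)
    (hcomm' : ∀ n x, Commute (a' n) x)
    (hrel : ∀ n, ∑ q ∈ Finset.HasAntidiagonal.antidiagonal n, (-1) ^ q.1 * (a q.1 * b' q.2) =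
      ∑ q ∈ Finset.HasAntidiagonal.antidiagonal n, (-1) ^ q.1 * (b q.1 * a' q.2))
    (f : S →+* S) (hfa : ∀ n, f (a n) = a' n) (hfa' : ∀ n, f (a' n) = a n)
    (hfb : ∀ n, f (b n) = b' n) (n : ℕ) : f (b' n) = b n := by
  refine eq_of_sum_antidiagonal_eq (c := a') (u := fun n => f (b' n)) ha' (fun n => ?_) n
  have h1 := congrArg f (hrel n)
  simp only [map_sum, map_mul, map_pow, map_neg, map_one, hfa, hfa', hfb] at h1
  rw [h1]
  have h2 := sum_antidiagonal_neg_one_pow_swap (fun i j => a i * b' j) n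
  have h3 := sum_antidiagonal_neg_one_pow_swap (fun i j => b i * a' j) n
  simp only [(hcomm _ _).eq] at h2
  simp only [← (hcomm' _ _).eq] at h3
  rw [h2, h3]
  congr 1
  simpa only [(hcomm _ _).eq, ← (hcomm' _ _).eq] using hrel n

end DualPairs

/-! ### Superpartitions and leading exponents. -/

section Counting

theorem sum_getD (l : List ℕ) (n : ℕ) (hl : l.length ≤ n) :
    ∑ i : Fin n, l.getD i 0 = l.sum := by
  induction l generalizing n with
  | nil => simp
  | cons a l ih =>
    rcases n with _ | n
    · simp at hl
    · rw [Fin.sum_univ_succ, List.sum_cons, ← ih n (by simpa using hl)]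
      simp

theorem list_length_le_sum (l : List ℕ) (hl : ∀ a ∈ l, 0 < a) : l.length ≤ l.sum := by
  induction l with
  | nil => simp
  | cons a l ih =>
    have h1 := hl a (by simp)
    have h2 := ih fun b hb => hl b (by simp [hb])
    simp only [List.length_cons, List.sum_cons]
    omega

theorem getD_antitone {l : List ℕ} (hl : l.Pairwise (· ≥ ·)) :
    Antitone fun i => l.getD i 0 := by
  intro i j hij
  dsimp only
  rcases lt_or_ge j l.length with hj | hj
  · rw [List.getD_eq_getElem _ _ hj, List.getD_eq_getElem _ _ (hij.trans_lt hj)]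
    rcases hij.eq_or_lt with rfl | hij
    · exact le_rfl
    · exact List.pairwise_iff_getElem.1 hl i j _ _ hij
  · rw [List.getD_eq_default _ _ hj]
    exact Nat.zero_le _

theorem length_le_of_getD_eq {l l' : List ℕ} {n : ℕ} (hl : l.length ≤ n) (hpos : ∀ a ∈ l, 0 < a)
    (h : ∀ i < n, l.getD i 0 = l'.getD i 0) : l.length ≤ l'.length := by
  by_contra! hlt
  have h1 := h l'.length (hlt.trans_le hl)
  rw [List.getD_eq_getElem _ _ hlt, List.getD_eq_default _ _ le_rfl] at h1
  exact (hpos _ (List.getElem_mem hlt)).ne' h1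

theorem list_eq_of_getD_eq {l l' : List ℕ} {n : ℕ} (hlen : l.length = l'.length)
    (hl : l.length ≤ n) (h : ∀ i < n, l.getD i 0 = l'.getD i 0) : l = l' := by
  refine List.ext_getElem hlen fun i h1 h2 => ?_
  have := h i (h1.trans_le hl)
  rwa [List.getD_eq_getElem _ _ h1, List.getD_eq_getElem _ _ h2] at this

theorem SParDeg.symm_length_le {n m : ℕ} (L : SParDeg n m) : L.1.symm.length ≤ n := by
  have h1 := list_length_le_sum _ L.1.symm_pos
  have h2 := L.2.1
  unfold SPar.deg at h2
  omega

/-- The leading exponent attached to a superpartition. -/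
def SParDeg.exps {n m : ℕ} (L : SParDeg n m) : Fin (n + m) →₀ ℕ :=
  Finsupp.equivFunOnFinite.symm
    (Fin.append (fun i => L.1.symm.getD i 0) fun r => L.1.anti.getD r 0)

theorem SParDeg.exps_castAdd {n m : ℕ} (L : SParDeg n m) (i : Fin n) :
    L.exps (Fin.castAdd m i) = L.1.symm.getD i 0 :=
  Fin.append_left (fun i : Fin n => L.1.symm.getD i 0) (fun r : Fin m => L.1.anti.getD r 0) i

theorem SParDeg.exps_natAdd {n m : ℕ} (L : SParDeg n m) (r : Fin m) :
    L.exps (Fin.natAdd n r) = L.1.anti.getD r 0 :=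
  Fin.append_right (fun i : Fin n => L.1.symm.getD i 0) (fun r : Fin m => L.1.anti.getD r 0) r

theorem SParDeg.exps_mem {n m : ℕ} (L : SParDeg n m) : L.exps ∈ topExps n m := by
  have hlen : L.1.anti.length = m := L.2.2
  refine ⟨fun i j hij => ?_, fun i j hij => ?_, ?_⟩
  · rw [Function.comp_apply, Function.comp_apply, exps_castAdd, exps_castAdd]
    exact getD_antitone L.1.symm_sorted (Fin.le_def.1 hij)
  · have hi : (i : ℕ) < L.1.anti.length := by rw [hlen]; exact i.2
    have hj : (j : ℕ) < L.1.anti.length := by rw [hlen]; exact j.2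
    have := List.pairwise_iff_getElem.1 L.1.anti_sorted i j hi hj hij
    rw [Function.comp_apply, Function.comp_apply, exps_natAdd, exps_natAdd,
      List.getD_eq_getElem _ _ hi, List.getD_eq_getElem _ _ hj]
    exact this
  · rw [Fin.sum_univ_add]
    simp only [exps_castAdd, exps_natAdd]
    rw [sum_getD _ _ L.symm_length_le, sum_getD _ _ hlen.le, add_comm]
    exact L.2.1

/-- The padding zeros lose nothing: parts of `symm` are positive, so its length can be recovered,
and `anti`, which may contain 0, has the fixed length `m`. -/
theorem SParDeg.exps_injective (n m : ℕ) :
    Function.Injective (SParDeg.exps : SParDeg n m → Fin (n + m) →₀ ℕ) := by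
  intro L M hLM
  have h1 : ∀ i < n, L.1.symm.getD i 0 = M.1.symm.getD i 0 := fun i hi => by
    have := DFunLike.congr_fun hLM (Fin.castAdd m ⟨i, hi⟩)
    rwa [exps_castAdd, exps_castAdd] at this
  have h2 : ∀ i < m, L.1.anti.getD i 0 = M.1.anti.getD i 0 := fun i hi => by
    have := DFunLike.congr_fun hLM (Fin.natAdd n ⟨i, hi⟩)
    rwa [exps_natAdd, exps_natAdd] at this
  refine Subtype.ext (SPar.ext ?_ ?_)
  · exact list_eq_of_getD_eq (L.2.2.trans M.2.2.symm) L.2.2.le h2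
  · refine list_eq_of_getD_eq (le_antisymm ?_ ?_) L.symm_length_le h1
    · exact length_le_of_getD_eq L.symm_length_le L.1.symm_pos h1
    · exact length_le_of_getD_eq M.symm_length_le M.1.symm_pos fun i hi => (h1 i hi).symm

/-- A finite spanning family with at most as many members as a basis is linearly independent. -/
theorem linearIndependent_of_span_of_injective {k M ι κ : Type*} [CommRing k] [AddCommGroup M]
    [Module k M] [Finite ι] (b : Module.Basis κ k M) {v : ι → M}
    (hv : ⊤ ≤ Submodule.span k (Set.range v)) {D : ι → κ} (hD : Function.Injective D) :
    LinearIndependent k v := by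
  let φ := Finsupp.linearCombination k v
  have hφ : Function.Surjective φ := by
    rw [← LinearMap.range_eq_top, Finsupp.range_linearCombination]
    exact top_le_iff.1 hv
  -- Keeping only the coordinates indexed by the image of `D` gives a surjection back to `ι →₀ k`;
  -- composed with `φ` it is a surjective endomorphism of a finitely generated module, hence
  -- injective.
  let ρ : M →ₗ[k] (ι →₀ k) := (Finsupp.lcomapDomain D hD).comp b.repr.toLinearMap
  have hρ : Function.Surjective ρ := fun x => by
    refine ⟨b.repr.symm (Finsupp.mapDomain D x), ?_⟩
    simp only [ρ, LinearMap.comp_apply, LinearEquiv.coe_coe, LinearEquiv.apply_symm_apply]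
    exact Finsupp.comapDomain_mapDomain D hD x
  have hinj : Function.Injective (ρ ∘ φ) :=
    OrzechProperty.injective_of_surjective_endomorphism (ρ.comp φ) (hρ.comp hφ)
  exact Function.Injective.of_comp (f := ρ) hinj

end Counting

/-! ### The bases of the e_Λ. -/

section Bases

variable (R : Type) [CommRing R]

attribute [local instance] symRingAddCommGroup symDegAddCommGroup

/-- The elements `e_Λ` of degree `(n|m)`. -/
def eProdDeg (n m : ℕ) (L : SParDeg n m) : SymDeg R n m :=
  ⟨eProd R L.1, superProd_mem (e_mem R) (et_mem R) L⟩

theorem eProd_mem (L : SPar) : eProd R L ∈ SymDeg R L.deg L.fdeg :=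
  (eProdDeg R _ _ ⟨L, rfl, rfl⟩).2

/-- The relation E(-t) H(t) = 1 expresses each h through the e's, and p̃ is by definition a
polynomial in the ẽ's and h's. -/
theorem pt_mem_of_forall_mem {V : Subalgebra R (SymRing R)} (he : ∀ n, e R n ∈ V)
    (het : ∀ n, et R n ∈ V) (n : ℕ) : pt R n ∈ V := by
  have hh : ∀ n, h R n ∈ V := mem_of_sum_antidiagonal (S := SymRing R) V (e_zero R) (sum_e_mul_h R) he
  exact sum_antidiagonal_mem (S := SymRing R) V het hh n

theorem leadElem_mem_of_forall_mem {V : Subalgebra R (SymRing R)} (he : ∀ n, e R n ∈ V)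
    (het : ∀ n, et R n ∈ V) {n m : ℕ} (d : Fin (n + m) →₀ ℕ) : leadElem R d ∈ V := by
  refine V.mul_mem (V.list_prod_mem fun x hx => ?_) (V.list_prod_mem fun x hx => ?_)
  · obtain ⟨i, rfl⟩ := List.mem_ofFn.1 hx
    exact pt_mem_of_forall_mem R he het _
  · obtain ⟨i, rfl⟩ := List.mem_ofFn.1 hx
    exact V.pow_mem (he _) _

theorem leadElem_mem_adjoin {n m : ℕ} (d : Fin (n + m) →₀ ℕ) :
    leadElem R d ∈ Algebra.adjoin R (Set.range (e R) ∪ Set.range (et R)) :=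
  leadElem_mem_of_forall_mem R (fun n => Algebra.subset_adjoin (Or.inl ⟨n, rfl⟩))
    (fun n => Algebra.subset_adjoin (Or.inr ⟨n, rfl⟩)) d

variable [IsDomain R] [CharZero R]

theorem span_eProdDeg (n m : ℕ) : ⊤ ≤ Submodule.span R (Set.range (eProdDeg R n m)) := by
  rw [← (leadBasis R n m).span_eq, Submodule.span_le]
  rintro _ ⟨d, rfl⟩
  have h1 := (isSuperPair_e R).mem_span_of_mem_adjoin (leadElem_mem_adjoin R d.1)
  have h2 : degProj R n m (leadElem R d.1) = leadBasis R n m d := by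
    rw [degProj_of_mem (leadElem_mem R d.2)]
    exact Subtype.ext (leadBasis_apply R d).symm
  rw [SetLike.mem_coe, ← h2]
  generalize leadElem R d.1 = x at h1 ⊢
  -- The span available runs over all superpartitions; projecting to degree `(n|m)` kills those of
  -- any other degree.
  induction h1 using Submodule.span_induction with
  | mem x hx =>
    obtain ⟨L, rfl⟩ := hx
    by_cases hL : (L.deg, L.fdeg) = (n, m)
    · obtain ⟨hn, hm⟩ := Prod.mk.inj hL
      refine Submodule.subset_span ⟨⟨L, hn, hm⟩, ?_⟩
      exact (degProj_of_mem (eProdDeg R n m ⟨L, hn, hm⟩).2).symm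
    · rw [← eProd_eq R, degProj_of_mem_of_ne (eProd_mem R L) hL]
      exact zero_mem _
  | zero => rw [map_zero]; exact zero_mem _
  | add x y _ _ hx hy => rw [map_add]; exact add_mem hx hy
  | smul c x _ hx => rw [map_smul]; exact Submodule.smul_mem _ c hx

/-- The basis `e_Λ` of the symmetric superfunctions of degree `(n|m)`. -/
def eBasisDeg (n m : ℕ) : Module.Basis (SParDeg n m) R (SymDeg R n m) :=
  Module.Basis.mk
    (linearIndependent_of_span_of_injective (leadBasis R n m) (span_eProdDeg R n m)
      (D := fun L => ⟨L.exps, L.exps_mem⟩)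
      fun _ _ hLM => SParDeg.exps_injective n m (congrArg Subtype.val hLM))
    (span_eProdDeg R n m)

theorem eBasisDeg_apply {n m : ℕ} (L : SParDeg n m) :
    (eBasisDeg R n m L : SymRing R) = eProd R L.1 := by
  rw [eBasisDeg, Module.Basis.mk_apply]
  rfl

theorem mem_span_eProd {n m : ℕ} {f : SymRing R} (hf : f ∈ SymDeg R n m) :
    f ∈ Submodule.span R (Set.range fun L : SParDeg n m => eProd R L.1) := by
  have h1 := Submodule.mem_map_of_mem (f := (SymDeg R n m).subtype)
    (span_eProdDeg R n m (Submodule.mem_top (x := ⟨f, hf⟩)))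
  rw [Submodule.map_span, ← Set.range_comp] at h1
  exact h1

theorem span_eProd : ⊤ ≤ Submodule.span R (Set.range (eProd R)) := by
  rw [← iSup_SymDeg]
  refine iSup_le fun d f hf => ?_
  refine Submodule.span_mono ?_ (mem_span_eProd R hf)
  rintro _ ⟨L, rfl⟩
  exact ⟨L.1, rfl⟩

/-- Degree projection followed by a coordinate in that degree gives a dual family. -/
theorem linearIndependent_eProd : LinearIndependent R (eProd R) := by
  refine LinearIndependent.of_pairwise_dual_eq_zero_one _
    (fun L => ((eBasisDeg R L.deg L.fdeg).coord ⟨L, rfl, rfl⟩).comp (degProj R L.deg L.fdeg)) ?_ ?_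
  · intro L M hLM
    rw [LinearMap.comp_apply]
    by_cases hdeg : (M.deg, M.fdeg) = (L.deg, L.fdeg)
    · obtain ⟨hn, hm⟩ := Prod.mk.inj hdeg
      have h1 : degProj R L.deg L.fdeg (eProd R M) = eBasisDeg R _ _ ⟨M, hn, hm⟩ := by
        rw [degProj_of_mem (f := eProd R M) (eProdDeg R _ _ ⟨M, hn, hm⟩).2]
        exact Subtype.ext (eBasisDeg_apply R ⟨M, hn, hm⟩).symm
      rw [h1, Module.Basis.coord_apply, Module.Basis.repr_self, Finsupp.single_eq_of_ne]
      exact fun h => hLM (congrArg Subtype.val h)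
    · rw [degProj_of_mem_of_ne (eProd_mem R M) hdeg, map_zero]
  · intro L
    rw [LinearMap.comp_apply]
    have h1 : degProj R L.deg L.fdeg (eProd R L) = eBasisDeg R _ _ ⟨L, rfl, rfl⟩ := by
      rw [degProj_of_mem (eProd_mem R L)]
      exact Subtype.ext (eBasisDeg_apply R ⟨L, rfl, rfl⟩).symm
    rw [h1, Module.Basis.coord_apply, Module.Basis.repr_self, Finsupp.single_eq_same]

/-- The basis `e_Λ` of the ring of symmetric superfunctions. -/
def eBasis : Module.Basis SPar R (SymRing R) :=
  Module.Basis.mk (linearIndependent_eProd R) (span_eProd R)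

theorem eBasis_apply (L : SPar) : eBasis R L = eProd R L := by
  rw [eBasis, Module.Basis.mk_apply]

end Bases

/-! ### The involution and the bases of the h_Λ. -/

section Involution

variable (R : Type) [CommRing R] [IsDomain R] [CharZero R]

attribute [local instance] symRingAddCommGroup symDegAddCommGroup

theorem exists_omega : ∃ ω : SymRing R →ₐ[R] SymRing R,
    (∀ n, ω (e R n) = h R n) ∧ (∀ n, ω (et R n) = ht R n) :=
  (isSuperPair_e R).exists_algHom (eBasis R) (eBasis_apply R) (isSuperPair_h R)

variable {R}

theorem algHom_ext_e {ω ω' : SymRing R →ₐ[R] SymRing R} (h1 : ∀ n, ω (e R n) = ω' (e R n))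
    (h2 : ∀ n, ω (et R n) = ω' (et R n)) : ω = ω' := by
  refine AlgHom.ext_of_adjoin_eq_top (adjoin_eq_top_of_basis (a := e R) (b := et R) (eBasis R) (eBasis_apply R)) ?_
  rintro _ (⟨n, rfl⟩ | ⟨n, rfl⟩)
  · exact h1 n
  · exact h2 n

section Dual

variable {R : Type*} [CommRing R] {ω : SymRing R →ₐ[R] SymRing R}

theorem omega_h (h1 : ∀ n, ω (e R n) = h R n) (n : ℕ) : ω (h R n) = e R n :=
  map_dual_even (S := SymRing R) (h_zero R) (e_commute R) (sum_e_mul_h R) (ω : SymRing R →+* SymRing R) h1 n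

theorem omega_ht (h1 : ∀ n, ω (e R n) = h R n) (h2 : ∀ n, ω (et R n) = ht R n) (n : ℕ) :
    ω (ht R n) = et R n :=
  map_dual_odd (S := SymRing R) (h_zero R) (e_commute R) (h_commute R) (sum_e_mul_ht R)
    (ω : SymRing R →+* SymRing R) h1 (omega_h h1) h2 n

theorem omega_eProd (h1 : ∀ n, ω (e R n) = h R n) (h2 : ∀ n, ω (et R n) = ht R n) (L : SPar) :
    ω (eProd R L) = hProd R L := by
  refine (map_superProd (S := SymRing R) (T := SymRing R) (ω : SymRing R →+* SymRing R) L).trans ?_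
  exact congrArg₂ (fun a b => superProd a b L) (funext h1) (funext h2)

end Dual

variable {ω : SymRing R →ₐ[R] SymRing R}

theorem omega_comp (h1 : ∀ n, ω (e R n) = h R n) (h2 : ∀ n, ω (et R n) = ht R n) :
    ω.comp ω = AlgHom.id R (SymRing R) :=
  algHom_ext_e (fun n => by rw [AlgHom.comp_apply, h1, omega_h h1, AlgHom.id_apply])
    fun n => by rw [AlgHom.comp_apply, h2, omega_ht h1 h2, AlgHom.id_apply]

theorem omega_omega (h1 : ∀ n, ω (e R n) = h R n) (h2 : ∀ n, ω (et R n) = ht R n)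
    (x : SymRing R) : ω (ω x) = x :=
  AlgHom.congr_fun (omega_comp h1 h2) x

/-- Preservation of degree is what allows the involution to be restricted to one degree, and so to
carry the basis e_Λ there to h_Λ. -/
theorem omega_mem (h1 : ∀ n, ω (e R n) = h R n) (h2 : ∀ n, ω (et R n) = ht R n) {n m : ℕ}
    {f : SymRing R} (hf : f ∈ SymDeg R n m) : ω f ∈ SymDeg R n m := by
  have hle : Submodule.span R (Set.range fun L : SParDeg n m => eProd R L.1) ≤
      (SymDeg R n m).comap ω.toLinearMap := by
    rw [Submodule.span_le]
    rintro _ ⟨L, rfl⟩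
    change ω (eProd R L.1) ∈ SymDeg R n m
    rw [omega_eProd h1 h2]
    exact superProd_mem (h_mem R) (ht_mem R) L
  exact hle (mem_span_eProd R hf)

variable (R)

theorem exists_hBasis : ∃ b : Module.Basis SPar R (SymRing R), ∀ L, b L = hProd R L := by
  obtain ⟨ω, h1, h2⟩ := exists_omega R
  refine ⟨(eBasis R).map (LinearEquiv.ofInvolutive ω.toLinearMap (omega_omega h1 h2)),
    fun L => ?_⟩
  rw [Module.Basis.map_apply, eBasis_apply]
  exact omega_eProd h1 h2 L

theorem exists_hBasisDeg (n m : ℕ) : ∃ b : Module.Basis (SParDeg n m) R (SymDeg R n m),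
    ∀ L, (b L : SymRing R) = hProd R L.1 := by
  obtain ⟨ω, h1, h2⟩ := exists_omega R
  refine ⟨(eBasisDeg R n m).map (LinearEquiv.ofInvolutive
    (ω.toLinearMap.restrict fun f hf => omega_mem h1 h2 hf)
    fun f => Subtype.ext (omega_omega h1 h2 f.1)), fun L => ?_⟩
  rw [Module.Basis.map_apply]
  refine Eq.trans ?_ (omega_eProd h1 h2 L.1)
  exact congrArg ω (eBasisDeg_apply R L)

end Involution

end SymSuper

end

theorem mainTheorem4 :
    (∃ ω : SymSuper.SymRing ℤ →+* SymSuper.SymRing ℤ,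
      ((∀ n, ω (SymSuper.e ℤ n) = SymSuper.h ℤ n) ∧ (∀ n, ω (SymSuper.et ℤ n) = SymSuper.ht ℤ n)) ∧
      (∀ ω' : SymSuper.SymRing ℤ →+* SymSuper.SymRing ℤ,
        (∀ n, ω' (SymSuper.e ℤ n) = SymSuper.h ℤ n) → (∀ n, ω' (SymSuper.et ℤ n) = SymSuper.ht ℤ n) →
        ω' = ω) ∧
      ω.comp ω = RingHom.id (SymSuper.SymRing ℤ) ∧
      (∀ n, ω (SymSuper.h ℤ n) = SymSuper.e ℤ n) ∧
      (∀ n, ω (SymSuper.ht ℤ n) = SymSuper.et ℤ n) ∧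
      (∀ L, ω (SymSuper.eProd ℤ L) = SymSuper.hProd ℤ L) ∧
      (∀ L, ω (SymSuper.hProd ℤ L) = SymSuper.eProd ℤ L)) ∧
    (∀ n m, ∃ b : Module.Basis (SymSuper.SParDeg n m) ℤ (SymSuper.SymDeg ℤ n m),
      ∀ L, (b L : SymSuper.SymRing ℤ) = SymSuper.eProd ℤ L.1) ∧
    (∀ n m, ∃ b : Module.Basis (SymSuper.SParDeg n m) ℤ (SymSuper.SymDeg ℤ n m),
      ∀ L, (b L : SymSuper.SymRing ℤ) = SymSuper.hProd ℤ L.1) ∧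
    (∃ b : Module.Basis SymSuper.SPar ℤ (SymSuper.SymRing ℤ), ∀ L, b L = SymSuper.eProd ℤ L) ∧
    (∃ b : Module.Basis SymSuper.SPar ℤ (SymSuper.SymRing ℤ), ∀ L, b L = SymSuper.hProd ℤ L) := by
  refine ⟨?_, fun n m => ⟨SymSuper.eBasisDeg ℤ n m, SymSuper.eBasisDeg_apply ℤ⟩,
    SymSuper.exists_hBasisDeg ℤ, ⟨SymSuper.eBasis ℤ, SymSuper.eBasis_apply ℤ⟩,
    SymSuper.exists_hBasis ℤ⟩
  obtain ⟨ω, h1, h2⟩ := SymSuper.exists_omega ℤ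
  refine ⟨ω, ⟨h1, h2⟩, fun ω' h1' h2' => ?_, RingHom.ext (SymSuper.omega_omega h1 h2),
    SymSuper.omega_h h1, SymSuper.omega_ht h1 h2, SymSuper.omega_eProd h1 h2, fun L => ?_⟩
  · let ω'' : SymSuper.SymRing ℤ →ₐ[ℤ] SymSuper.SymRing ℤ := { ω' with
      commutes' := fun r => RingHom.congr_fun (RingHom.ext_int
        (ω'.comp (algebraMap ℤ (SymSuper.SymRing ℤ))) (algebraMap ℤ (SymSuper.SymRing ℤ))) r }
    have hω : ω'' = ω := SymSuper.algHom_ext_e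
      (fun n => (h1' n).trans (h1 n).symm) fun n => (h2' n).trans (h2 n).symm
    exact RingHom.ext fun x => AlgHom.congr_fun hω x
  · exact (congrArg ω (SymSuper.omega_eProd h1 h2 L).symm).trans
      (SymSuper.omega_omega h1 h2 (SymSuper.eProd ℤ L))
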